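/- Let $K$ be an infinite field with $\operatorname{char}K\neq 2$. All algebras are unital. Let $J=J_2$ be the Jordan algebra of the symmetric $2\times 2$ matrices over $K$ with product $u\circ v=\frac12(uv+vu)$, graded by $\mathbb Z_2$ as $J=J_0\oplus J_1$ with $J_0=\operatorname{span}(I,a)$, $J_1=\operatorname{span}(b)$, where $I$ is the identity matrix, $a=e_{11}-e_{22}$ and $b=e_{12}+e_{21}$. Let $J(X)$ be the free unital Jordan algebra over $K$ on $X=Y\cup Z$, where $Y=\{y_i\}$ and $Z=\{z_i\}$ are disjoint countably infinite sets; $J(X)$ is $\mathbb Z_2$-graded, a monomial being even or odd according to the parity of its total degree in the variables from $Z$. An element of $J(X)$ is a graded identity of $J$ if it vanishes whenever the variables $y_i$ are replaced by elements of $J_0$ and the variables $z_i$ by elements of $J_1$. A graded T-ideal of $J(X)$ is an ideal closed under all endomorphisms of $J(X)$ that respect the grading. Write $(u,v,w)=(uv)w-u(vw)$ and $(u_1,u_2,u_3,u_4,u_5)=((u_1,u_2,u_3),u_4,u_5)$; below $x_i$ and $x$ denote variables that may be even or odd (and are different from the other variables in the same expression), and $|x_i|$ denotes the degree of $x_i$.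 Theorem. The ideal $T$ of the graded identities of $J$ is generated, as a graded T-ideal, by the polynomials 1. $x_1(x_2x_3)-x_2(x_1x_3)$ whenever $|x_1|=|x_2|$; 2. $(y_1y_2,z_1,z_2)-\bigl(y_1(y_2,z_1,z_2)+y_2(y_1,z_1,z_2)-2z_1(z_2,y_1,y_2)\bigr)$; 3. $(y_1y_2,y_3,z_1)-\bigl(y_1(y_2,y_3,z_1)+y_2(y_1,y_3,z_1)\bigr)$; 4. $(z_1z_2,x_1,x_2)$; 5. $(y_1,y_2,z_1,x,y_3)-(y_1,y_3,z_1,x,y_2)$. -/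

import Mathlib

noncomputable section

/-! ### The free unital Jordan algebra on a set -/

/-- The free unital nonassociative `K`-algebra on `X`: the linear combinations of the
nonassociative words in `X`, the empty word included. -/
abbrev FreeUnitalNonAssoc (K X : Type*) [Field K] : Type _ :=
  MonoidAlgebra K (WithOne (FreeMagma X))

/-- The laws of Jordan algebras: commutativity and `(ab)a² = a(ba²)`. -/
inductive JordanLaw (K X : Type*) [Field K] :
    FreeUnitalNonAssoc K X → FreeUnitalNonAssoc K X → Prop
  | comm (a b : FreeUnitalNonAssoc K X) : JordanLaw K X (a * b) (b * a)
  | jordan (a b : FreeUnitalNonAssoc K X) :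
      JordanLaw K X (a * b * (a * a)) (a * (b * (a * a)))

/-- The free unital Jordan algebra over `K` on `X`: the quotient of the free unital
nonassociative algebra by the smallest congruence that contains the Jordan laws. -/
def FreeJordan (K X : Type*) [Field K] : Type _ :=
  (ringConGen (JordanLaw K X)).Quotient

namespace FreeJordan

section
variable (K X : Type*) [Field K]

/-- The quotient map. -/
def mk : FreeUnitalNonAssoc K X → FreeJordan K X :=
  fun a => (a : (ringConGen (JordanLaw K X)).Quotient)

instance : NonAssocRing (FreeJordan K X) :=
  inferInstanceAs (NonAssocRing (ringConGen (JordanLaw K X)).Quotient)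

instance : DistribMulAction K (FreeJordan K X) :=
  inferInstanceAs (DistribMulAction K (ringConGen (JordanLaw K X)).Quotient)

instance : IsScalarTower K (FreeJordan K X) (FreeJordan K X) :=
  inferInstanceAs (IsScalarTower K (ringConGen (JordanLaw K X)).Quotient
    (ringConGen (JordanLaw K X)).Quotient)

instance : SMulCommClass K (FreeJordan K X) (FreeJordan K X) :=
  inferInstanceAs (SMulCommClass K (ringConGen (JordanLaw K X)).Quotient
    (ringConGen (JordanLaw K X)).Quotient)

theorem mk_surjective : Function.Surjective (mk K X) :=
  (ringConGen (JordanLaw K X)).mk'_surjective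

theorem mk_add (a b : FreeUnitalNonAssoc K X) : mk K X (a + b) = mk K X a + mk K X b := rfl

theorem mk_mul (a b : FreeUnitalNonAssoc K X) : mk K X (a * b) = mk K X a * mk K X b := rfl

theorem mk_one : mk K X 1 = 1 := rfl

theorem mk_smul (c : K) (a : FreeUnitalNonAssoc K X) : mk K X (c • a) = c • mk K X a := rfl

theorem mk_eq_of_law {a b : FreeUnitalNonAssoc K X} (h : JordanLaw K X a b) :
    mk K X a = mk K X b :=
  (RingCon.eq _).2 (RingConGen.Rel.of _ _ h)

instance : Module K (FreeJordan K X) where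
  add_smul c d x := by
    obtain ⟨a, rfl⟩ := mk_surjective K X x
    rw [← mk_smul, ← mk_smul, ← mk_smul, ← mk_add, add_smul]
  zero_smul x := by
    obtain ⟨a, rfl⟩ := mk_surjective K X x
    rw [← mk_smul, zero_smul]
    rfl

instance : NonAssocCommRing (FreeJordan K X) where
  mul_comm x y := by
    obtain ⟨a, rfl⟩ := mk_surjective K X x
    obtain ⟨b, rfl⟩ := mk_surjective K X y
    rw [← mk_mul, ← mk_mul]
    exact mk_eq_of_law K X (.comm a b)

instance : IsCommJordan (FreeJordan K X) where
  lmul_comm_rmul_rmul x y := by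
    obtain ⟨a, rfl⟩ := mk_surjective K X x
    obtain ⟨b, rfl⟩ := mk_surjective K X y
    exact mk_eq_of_law K X (.jordan a b)

/-- The class of a nonassociative word in the free Jordan algebra. -/
def monomial (m : WithOne (FreeMagma X)) : FreeJordan K X :=
  mk K X (MonoidAlgebra.single m 1)

/-- The free generators. -/
def of (x : X) : FreeJordan K X :=
  monomial K X (FreeMagma.of x : FreeMagma X)

end

section
variable {K X : Type*} [Field K]
variable {B : Type*} [NonAssocCommRing B] [Module K B] [IsScalarTower K B B]
  [SMulCommClass K B B]

/-- Evaluation of the elements of the free unital nonassociative algebra under a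
substitution of the variables. -/
def preLift (σ : X → B) : FreeUnitalNonAssoc K X →+* B where
  toFun := MonoidAlgebra.liftMagma K (WithOne.lift (FreeMagma.lift σ)).toMulHom
  map_one' := by
    rw [MonoidAlgebra.one_def]
    simp [MonoidAlgebra.liftMagma]
  map_mul' := map_mul _
  map_zero' := map_zero _
  map_add' := map_add _

/-- Evaluation of the elements of the free Jordan algebra in a unital Jordan algebra `B` under
a substitution `σ` of the variables, written `f ↦ f(σ)`: the unital algebra homomorphism that
extends `σ`. -/
def lift [IsCommJordan B] (σ : X → B) : FreeJordan K X →+* B :=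
  (ringConGen (JordanLaw K X)).lift (preLift σ) (RingCon.ringConGen_le.2 (by
    intro a b h
    cases h with
    | comm a b => simp only [RingCon.ker_apply, map_mul, mul_comm]
    | jordan a b =>
      simp only [RingCon.ker_apply, map_mul]
      exact IsCommJordan.lmul_comm_rmul_rmul _ _))

variable [IsCommJordan B]

theorem lift_of (σ : X → B) (x : X) : lift σ (of K X x) = σ x := by
  change MonoidAlgebra.liftMagma K (WithOne.lift (FreeMagma.lift σ)).toMulHom
    (MonoidAlgebra.single _ 1) = σ x
  simp [MonoidAlgebra.liftMagma]

theorem lift_smul (σ : X → B) (c : K) (f : FreeJordan K X) :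
    lift σ (c • f) = c • lift σ f := by
  obtain ⟨a, rfl⟩ := mk_surjective K X f
  exact map_smul (MonoidAlgebra.liftMagma K (WithOne.lift (FreeMagma.lift σ)).toMulHom) c a

end

end FreeJordan

/-! ### The `ℤ/2`-grading on the free Jordan algebra, graded identities, graded T-ideals -/

/-- The variables: `(0, i)` is the even variable `y_i` and `(1, i)` the odd variable `z_i`. -/
abbrev GrVar : Type := ZMod 2 × ℕ

/-- The `ℤ/2`-degree of a nonempty nonassociative word. -/
def FreeMagma.parity : FreeMagma GrVar → ZMod 2
  | .of x => x.1
  | .mul u v => u.parity + v.parity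

/-- The `ℤ/2`-degree of a nonassociative word; the empty word is even. -/
def wordParity (m : WithOne (FreeMagma GrVar)) : ZMod 2 :=
  WithOne.recOneCoe 0 FreeMagma.parity m

section
variable (K : Type*) [Field K]

/-- The free graded Jordan algebra `J(X)`, `X = Y ∪ Z`. -/
abbrev FreeGrJordan : Type _ := FreeJordan K GrVar

/-- The component `J(X)_p` of the free graded Jordan algebra: the span of the monomials of
`ℤ/2`-degree `p`. -/
def FreeGrJordan.component (p : ZMod 2) : Submodule K (FreeGrJordan K) :=
  Submodule.span K {f | ∃ m, wordParity m = p ∧ f = FreeJordan.monomial K GrVar m}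

variable {K}

/-- The graded identities of a unital Jordan algebra `B` with homogeneous components `𝒜 0` and
`𝒜 1`: the elements of `J(X)` that vanish whenever the even variables are replaced by elements of
`𝒜 0` and the odd ones by elements of `𝒜 1`. -/
def gradedIdentities {B : Type*} [NonAssocCommRing B] [IsCommJordan B] [Module K B]
    [IsScalarTower K B B] [SMulCommClass K B B] (𝒜 : ZMod 2 → Submodule K B) :
    Set (FreeGrJordan K) :=
  {f | ∀ σ : GrVar → B, (∀ x, σ x ∈ 𝒜 x.1) → FreeJordan.lift σ f = 0}

/-- A graded T-ideal of `J(X)`: an ideal that is closed under the graded endomorphisms of `J(X)`,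
that is, under the substitutions of elements of degree `p` for the variables of degree `p`. -/
structure IsGradedTIdeal (I : Submodule K (FreeGrJordan K)) : Prop where
  mul_mem : ∀ g f, f ∈ I → g * f ∈ I
  subst_mem : ∀ σ : GrVar → FreeGrJordan K, (∀ x, σ x ∈ FreeGrJordan.component K x.1) →
    ∀ f ∈ I, FreeJordan.lift σ f ∈ I

/-- The graded T-ideal generated by a set: the intersection of all that contain it. -/
def gradedTIdealSpan (S : Set (FreeGrJordan K)) : Submodule K (FreeGrJordan K) :=
  sInf {I | IsGradedTIdeal I ∧ S ⊆ I}

theorem subset_gradedTIdealSpan (S : Set (FreeGrJordan K)) :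
    S ⊆ (gradedTIdealSpan S : Set (FreeGrJordan K)) := by
  intro f hf
  simp only [gradedTIdealSpan, SetLike.mem_coe, Submodule.mem_sInf]
  exact fun I hI => hI.2 hf

theorem isGradedTIdeal_gradedTIdealSpan (S : Set (FreeGrJordan K)) :
    IsGradedTIdeal (gradedTIdealSpan S) where
  mul_mem g f hf := by
    simp only [gradedTIdealSpan, Submodule.mem_sInf] at hf ⊢
    exact fun I hI => hI.1.mul_mem g f (hf I hI)
  subst_mem σ hσ f hf := by
    simp only [gradedTIdealSpan, Submodule.mem_sInf] at hf ⊢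
    exact fun I hI => hI.1.subst_mem σ hσ f (hf I hI)

end

/-! ### The Jordan algebra of symmetric `2 × 2` matrices with the nonscalar grading -/

/-- The Jordan algebra `J₂` of the symmetric `2 × 2` matrices, as a vector space. -/
def SymMat2 (K : Type*) [Field K] : Submodule K (Matrix (Fin 2) (Fin 2) K) where
  carrier := {A | A.IsSymm}
  add_mem' := Matrix.IsSymm.add
  zero_mem' := Matrix.isSymm_zero
  smul_mem' c _ h := Matrix.IsSymm.smul h c

namespace SymMat2
variable {K : Type*} [Field K]

/-- The Jordan product `A ∘ B = (AB + BA) / 2`. -/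
instance : Mul (SymMat2 K) where
  mul A B := ⟨(2⁻¹ : K) • ((A : Matrix (Fin 2) (Fin 2) K) * B + B * A), by
    have hA : (A : Matrix (Fin 2) (Fin 2) K).transpose = A := A.2
    have hB : (B : Matrix (Fin 2) (Fin 2) K).transpose = B := B.2
    change Matrix.transpose _ = _
    rw [Matrix.transpose_smul, Matrix.transpose_add, Matrix.transpose_mul, Matrix.transpose_mul,
      hA, hB, add_comm]⟩

/-- The unit is the identity matrix. -/
instance : One (SymMat2 K) where
  one := ⟨1, Matrix.isSymm_one⟩

theorem coe_mul (A B : SymMat2 K) : ((A * B : SymMat2 K) : Matrix (Fin 2) (Fin 2) K) =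
    (2⁻¹ : K) • ((A : Matrix (Fin 2) (Fin 2) K) * B + B * A) := rfl

theorem coe_one : ((1 : SymMat2 K) : Matrix (Fin 2) (Fin 2) K) = 1 := rfl

protected theorem mul_comm (A B : SymMat2 K) : A * B = B * A :=
  Subtype.ext (by rw [coe_mul, coe_mul, add_comm])

protected theorem mul_add (A B C : SymMat2 K) : A * (B + C) = A * B + A * C :=
  Subtype.ext (by
    rw [Submodule.coe_add, coe_mul, coe_mul, coe_mul, Submodule.coe_add, ← smul_add, mul_add,
      add_mul]
    congr 1
    abel)

protected theorem mul_zero (A : SymMat2 K) : A * 0 = 0 :=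
  Subtype.ext (by rw [coe_mul, Submodule.coe_zero, mul_zero, zero_mul, add_zero, smul_zero])

protected theorem mul_one [NeZero (2 : K)] (A : SymMat2 K) : A * 1 = A :=
  Subtype.ext (by
    rw [coe_mul, coe_one, mul_one, one_mul, ← two_smul K (A : Matrix (Fin 2) (Fin 2) K),
      smul_smul, inv_mul_cancel₀ (NeZero.ne (2 : K)), one_smul])

instance [NeZero (2 : K)] : NonAssocCommRing (SymMat2 K) :=
  { (inferInstance : AddCommGroup (SymMat2 K)),
    (inferInstance : Mul (SymMat2 K)), (inferInstance : One (SymMat2 K)) with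
    mul_comm := SymMat2.mul_comm
    left_distrib := SymMat2.mul_add
    right_distrib := fun A B C => by
      rw [SymMat2.mul_comm, SymMat2.mul_add, SymMat2.mul_comm C A, SymMat2.mul_comm C B]
    mul_zero := SymMat2.mul_zero
    zero_mul := fun A => by rw [SymMat2.mul_comm, SymMat2.mul_zero]
    mul_one := SymMat2.mul_one
    one_mul := fun A => by rw [SymMat2.mul_comm, SymMat2.mul_one] }

instance [NeZero (2 : K)] : IsCommJordan (SymMat2 K) where
  lmul_comm_rmul_rmul A B := Subtype.ext (by
    simp only [coe_mul, smul_mul_assoc, mul_smul_comm, smul_add, mul_add, add_mul, smul_smul,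
      mul_assoc]
    module)

instance [NeZero (2 : K)] : IsScalarTower K (SymMat2 K) (SymMat2 K) where
  smul_assoc c A B := Subtype.ext (by
    simp only [smul_eq_mul, coe_mul, Submodule.coe_smul, smul_mul_assoc, mul_smul_comm]
    module)

instance [NeZero (2 : K)] : SMulCommClass K (SymMat2 K) (SymMat2 K) where
  smul_comm c A B := Subtype.ext (by
    simp only [smul_eq_mul, coe_mul, Submodule.coe_smul, smul_mul_assoc, mul_smul_comm]
    module)

/-- `a = e₁₁ - e₂₂`. -/
def a : SymMat2 K := ⟨!![1, 0; 0, -1], by ext i j; fin_cases i <;> fin_cases j <;> rfl⟩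

/-- `b = e₁₂ + e₂₁`. -/
def b : SymMat2 K := ⟨!![0, 1; 1, 0], by ext i j; fin_cases i <;> fin_cases j <;> rfl⟩

variable (K) in
/-- The nonscalar grading: `J₀ = span(I, a)` and `J₁ = span(b)`. -/
def nonscalarGrading (p : ZMod 2) : Submodule K (SymMat2 K) :=
  if p = 0 then Submodule.span K {1, a} else Submodule.span K {b}

end SymMat2

/-! ### The five identities -/

section
variable {K : Type*} [Field K]

/-- The variable of degree `p` with index `i`. -/
def xv (p : ZMod 2) (i : ℕ) : FreeGrJordan K := FreeJordan.of K GrVar (p, i)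

/-- The even variable `y_i`. -/
def yv (i : ℕ) : FreeGrJordan K := xv 0 i

/-- The odd variable `z_i`. -/
def zv (i : ℕ) : FreeGrJordan K := xv 1 i

variable (K) in
/-- The five families of identities. `associator u v w = (u * v) * w - u * (v * w)`, and the
variables denoted by `xv` run over both degrees. -/
inductive BasisIdentity : FreeGrJordan K → Prop
  | one (p q : ZMod 2) : BasisIdentity
      (xv p 1 * (xv p 2 * xv q 3) - xv p 2 * (xv p 1 * xv q 3))
  | two : BasisIdentity
      (associator (yv 1 * yv 2) (zv 1) (zv 2)
        - (yv 1 * associator (yv 2) (zv 1) (zv 2) + yv 2 * associator (yv 1) (zv 1) (zv 2)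
          - 2 • (zv 1 * associator (zv 2) (yv 1) (yv 2))))
  | three : BasisIdentity
      (associator (yv 1 * yv 2) (yv 3) (zv 1)
        - (yv 1 * associator (yv 2) (yv 3) (zv 1) + yv 2 * associator (yv 1) (yv 3) (zv 1)))
  | four (p q : ZMod 2) : BasisIdentity
      (associator (zv 1 * zv 2) (xv p 3) (xv q 4))
  | five (p : ZMod 2) : BasisIdentity
      (associator (associator (yv 1) (yv 2) (zv 1)) (xv p 4) (yv 3)
        - associator (associator (yv 1) (yv 3) (zv 1)) (xv p 4) (yv 2))

end

end

/-! ### Graded algebras that satisfy the five identities -/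

/-! That the five identities hold in `J` is a computation with `a² = b² = 1`, `ab = 0`. For the
converse, let `F = F₀ + F₁` be the free graded Jordan algebra modulo the graded T-ideal they
generate. It suffices to show that the evaluations `y_i ↦ α_i + β_i a`, `z_i ↦ γ_i b` separate the
elements of `F`.

On `J₁` the element `y_i` acts as the scalar `α_i`, the associator `(y_i, y_j, ·)` as `β_i β_j`, and
`z_i z_j` as `γ_i γ_j`. So a word built from some `z_k` by these three operations takes as value a
monomial in the `α`, `β`, `γ` times `b`. If `w` is such a word, `w z_k` and `-(y_j, w, z_k)` take as
values monomials times `1` and `a` respectively.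

Two facts about `F` are needed. First, these words together with the products of the `y_i` span `F`,
because their span is closed under multiplication (`mul_mem_span_words`); identities 2 and 3 rewrite
the products that are not visibly words. Second, words of the same kind with the same generators in
the same roles are equal (`EvenVarWord.unique`, `OddWord.unique`, `EvenWord.unique`). Indeed,
multiplications by even elements commute by identity 1, hence so do the operators they generate,
among them `(u, v, ·)`; identity 5 permutes the entries of different associators; identities 1 and 4
permute the odd generators.

Distinct words of one kind that contain odd generators therefore give distinct monomials, which are
linearly independent functions over an infinite field (`eq_zero_of_forall_monomial`). Words in the
`y_i` alone become monomials at `β = γ = 0`, where the even words with odd generators vanish; this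
keeps the two kinds of even words apart (`rel_eq_zero`). -/

/-- A commutative algebra `F = F₀ + F₁` that satisfies the five identities, the variables of
degree `p` being replaced by elements of `F_p`. -/
structure BasisLaws {K F : Type*} [Field K] [NonAssocCommRing F] [Module K F]
    (F₀ F₁ : Submodule K F) : Prop where
  one_mem : (1 : F) ∈ F₀
  mul_mem₀₀ : ∀ {u v}, u ∈ F₀ → v ∈ F₀ → u * v ∈ F₀
  mul_mem₀₁ : ∀ {u w}, u ∈ F₀ → w ∈ F₁ → u * w ∈ F₁
  mul_mem₁₁ : ∀ {w w'}, w ∈ F₁ → w' ∈ F₁ → w * w' ∈ F₀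
  exists_add : ∀ x, ∃ u ∈ F₀, ∃ w ∈ F₁, x = u + w
  comm₀ : ∀ {u v}, u ∈ F₀ → v ∈ F₀ → ∀ x, u * (v * x) = v * (u * x)
  comm₁ : ∀ {w w'}, w ∈ F₁ → w' ∈ F₁ → ∀ x, w * (w' * x) = w' * (w * x)
  assoc_mul_odd : ∀ {u v w w'}, u ∈ F₀ → v ∈ F₀ → w ∈ F₁ → w' ∈ F₁ →
    associator (u * v) w w' =
      u * associator v w w' + v * associator u w w' - 2 • (w * associator w' u v)
  assoc_mul_even : ∀ {u v u' w}, u ∈ F₀ → v ∈ F₀ → u' ∈ F₀ → w ∈ F₁ →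
    associator (u * v) u' w = u * associator v u' w + v * associator u u' w
  assoc_odd_mul_odd : ∀ {w w'}, w ∈ F₁ → w' ∈ F₁ → ∀ x x', associator (w * w') x x' = 0
  assoc_swap : ∀ {u v v'}, u ∈ F₀ → v ∈ F₀ → v' ∈ F₀ → ∀ w x,
    associator (associator u v w) x v' = associator (associator u v' w) x v

namespace BasisLaws
variable {K F : Type*} [Field K] [NonAssocCommRing F] [Module K F] {F₀ F₁ : Submodule K F}

/-- The even component is associative, so the associator only sees the odd part of `x`. -/
theorem assoc_even_mem (h : BasisLaws F₀ F₁) {u v : F} (hu : u ∈ F₀) (hv : v ∈ F₀) (x : F) :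
    associator u v x ∈ F₁ := by
  obtain ⟨p, hp, w, hw, rfl⟩ := h.exists_add x
  have e : associator u v (p + w) = associator u v w := by
    have : (u * v) * p = u * (v * p) := by
      rw [mul_comm, mul_comm u v, h.comm₀ hp hv, mul_comm p u, h.comm₀ hv hu]
    simp only [associator, mul_add, this]
    abel
  rw [e]
  exact F₁.sub_mem (h.mul_mem₀₁ (h.mul_mem₀₀ hu hv) hw) (h.mul_mem₀₁ hu (h.mul_mem₀₁ hv hw))

theorem assoc_symm (h : BasisLaws F₀ F₁) {u v : F} (hu : u ∈ F₀) (hv : v ∈ F₀) (x : F) :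
    associator u v x = associator v u x := by
  simp only [associator]
  rw [mul_comm u v, h.comm₀ hu hv]

/-- Commutativity gives `(r, q, w) = -(w, q, r)`, which turns identity 5 into an exchange of entries
between two nested associators. -/
theorem assoc_assoc_even (h : BasisLaws F₀ F₁) {u v p q : F} (hu : u ∈ F₀) (hv : v ∈ F₀)
    (hp : p ∈ F₀) (x : F) :
    associator v q (associator u p x) = associator p q (associator u v x) := by
  have e : ∀ r w : F, associator r q w = - associator w q r := fun r w => by
    simp only [associator]
    rw [mul_comm (w * q) r, mul_comm w q, mul_comm r q, mul_comm w]
    abel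
  rw [e v, e p, h.assoc_swap hu hp hv]

/-- For odd `w` and `z` one has `(r, w, z) = -(w, z, r)`, since odd multiplications commute;
identity 5 then applies again. -/
theorem assoc_assoc_odd (h : BasisLaws F₀ F₁) {u v p z : F} (hu : u ∈ F₀) (hv : v ∈ F₀)
    (hp : p ∈ F₀) (hz : z ∈ F₁) (x : F) :
    associator v (associator u p x) z = associator p (associator u v x) z := by
  have e : ∀ r w : F, w ∈ F₁ → associator r w z = - associator w z r := fun r w hw => by
    simp only [associator]
    rw [mul_comm (w * z) r, h.comm₁ hw hz r, mul_comm r w, mul_comm z (w * r)]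
    abel
  rw [e _ _ (h.assoc_even_mem hu hp x), e _ _ (h.assoc_even_mem hu hv x), h.assoc_swap hu hp hv]

/-- Commutation of odd multiplications makes every multiplication self-adjoint for the product of
odd elements. -/
theorem adjoint (h : BasisLaws F₀ F₁) {w w' : F} (hw : w ∈ F₁) (hw' : w' ∈ F₁) (u : F) :
    w * (u * w') = (u * w) * w' := by
  rw [mul_comm u w', h.comm₁ hw hw', mul_comm w u, mul_comm]

theorem odd_mul_assoc (h : BasisLaws F₀ F₁) {w z w' : F} (hw : w ∈ F₁) (hz : z ∈ F₁)
    (hw' : w' ∈ F₁) : (w * z) * w' = (w' * z) * w := by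
  rw [mul_comm (w * z), mul_comm (w' * z), mul_comm w z, mul_comm w' z, h.comm₁ hw' hz,
    h.comm₁ hw hz, mul_comm w w']

/-- Identity 4 read through commutativity: a product of two odd elements passes through every
multiplication. -/
theorem central (h : BasisLaws F₀ F₁) {w w' : F} (hw : w ∈ F₁) (hw' : w' ∈ F₁) (x x' : F) :
    x * ((w * w') * x') = (w * w') * (x * x') := by
  have e := h.assoc_odd_mul_odd hw hw' x' x
  rw [associator, sub_eq_zero] at e
  rw [mul_comm x, e, mul_comm x]

theorem even_assoc (h : BasisLaws F₀ F₁) {u v p : F} (hu : u ∈ F₀) (hv : v ∈ F₀) (hp : p ∈ F₀) :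
    (u * v) * p = u * (v * p) := by
  rw [mul_comm, mul_comm u v, h.comm₀ hp hv, mul_comm p u, h.comm₀ hv hu]

end BasisLaws

/-! ### Operators -/

section EvenOp
variable {K F : Type*} [Field K] [NonAssocCommRing F] [Module K F] {F₀ F₁ : Submodule K F}

/-- The maps generated by the multiplications by elements of `F₀`. -/
inductive EvenOp (F₀ : Submodule K F) : (F → F) → Prop
  | id : EvenOp F₀ id
  | mul {u P} : u ∈ F₀ → EvenOp F₀ P → EvenOp F₀ fun x => u * P x
  | sub {P Q} : EvenOp F₀ P → EvenOp F₀ Q → EvenOp F₀ fun x => P x - Q x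

namespace EvenOp

theorem assoc (h : BasisLaws F₀ F₁) {u v : F} (hu : u ∈ F₀) (hv : v ∈ F₀) {P : F → F}
    (hP : EvenOp F₀ P) : EvenOp F₀ fun x => associator u v (P x) :=
  .sub (.mul (h.mul_mem₀₀ hu hv) hP) (.mul hu (.mul hv hP))

theorem comm (h : BasisLaws F₀ F₁) {P : F → F} (hP : EvenOp F₀ P) {u : F} (hu : u ∈ F₀) (x : F) :
    P (u * x) = u * P x := by
  induction hP generalizing x with
  | id => rfl
  | mul hv _ ih => simp only [ih, h.comm₀ hv hu]
  | sub _ _ ih ih' => simp only [ih, ih', mul_sub]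

theorem map_sub {P : F → F} (hP : EvenOp F₀ P) (x x' : F) : P (x - x') = P x - P x' := by
  induction hP generalizing x x' with
  | id => rfl
  | mul _ _ ih => simp only [ih, mul_sub]
  | sub _ _ ih ih' => simp only [ih, ih']; abel

/-- Generators commute by identity 1, hence so does all they generate. This makes the order of the
operations in a word irrelevant. -/
theorem comm_op (h : BasisLaws F₀ F₁) {P Q : F → F} (hP : EvenOp F₀ P) (hQ : EvenOp F₀ Q) (x : F) :
    P (Q x) = Q (P x) := by
  induction hQ with
  | id => rfl
  | mul hu _ ih => simp only [hP.comm h hu, ih]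
  | sub _ _ ih ih' => simp only [hP.map_sub, ih, ih']

theorem mem (h : BasisLaws F₀ F₁) {P : F → F} (hP : EvenOp F₀ P) {w : F} (hw : w ∈ F₁) :
    P w ∈ F₁ := by
  induction hP with
  | id => exact hw
  | mul hv _ ih => exact h.mul_mem₀₁ hv ih
  | sub _ _ ih ih' => exact F₁.sub_mem ih ih'

/-- Each multiplication is self-adjoint; taking adjoints reverses their order, which is harmless
because they commute. -/
theorem adjoint (h : BasisLaws F₀ F₁) {P : F → F} (hP : EvenOp F₀ P) {w w' : F} (hw : w ∈ F₁)
    (hw' : w' ∈ F₁) : w * P w' = P w * w' := by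
  induction hP generalizing w with
  | id => rfl
  | mul hv hP ih =>
    rw [h.adjoint hw (hP.mem h hw'), ih (h.mul_mem₀₁ hv hw), hP.comm h hv]
  | sub _ _ ih ih' => rw [mul_sub, sub_mul, ih hw, ih' hw]

/-- Exchange of two odd factors across an operator. -/
theorem exchange (h : BasisLaws F₀ F₁) {P : F → F} (hP : EvenOp F₀ P) {z z' g : F} (hz : z ∈ F₁)
    (hz' : z' ∈ F₁) (hg : g ∈ F₀) (hc : ∀ x x', x * (g * x') = g * (x * x')) :
    P (z' * g) * z = P (z * g) * z' := by
  rw [mul_comm z' g, mul_comm z g, hP.comm h hg, hP.comm h hg, mul_comm, hc,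
    hP.adjoint h hz hz', mul_comm (g * P z), hc, mul_comm z']

end EvenOp
end EvenOp

/-! ### Pairwise folds -/

section PairFold
variable {M N : Type*} (b : ℕ → ℕ → M → M) (e₀ : M → N) (e₁ : ℕ → M → N)

/-- Consume a list in pairs by `b`; finish by `e₀` or, if an entry is left over, by `e₁`. -/
def pairFold : List ℕ → M → N
  | [], x => e₀ x
  | [i], x => e₁ i x
  | i :: j :: l, x => pairFold l (b i j x)

variable {b e₀ e₁}

/-- An adjacent transposition acts inside a pair (`hb`), across two consecutive pairs (`hbb`), or
across the last pair and the left-over entry (`hb₁`). -/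
theorem pairFold_swap (hb : ∀ i j x, b i j x = b j i x)
    (hbb : ∀ i j k m x, b j m (b k i x) = b i m (b k j x))
    (hb₁ : ∀ i j k x, e₁ j (b k i x) = e₁ i (b k j x))
    (i j : ℕ) (l l' : List ℕ) (x : M) :
    pairFold b e₀ e₁ (l ++ i :: j :: l') x = pairFold b e₀ e₁ (l ++ j :: i :: l') x := by
  match l with
  | [] => simp only [List.nil_append, pairFold, hb]
  | [k] =>
    match l' with
    | [] => exact hb₁ i j k x
    | m :: l' => simp only [List.cons_append, List.nil_append, pairFold, hbb i j k m]
  | k :: k' :: l => exact pairFold_swap hb hbb hb₁ i j l l' _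

theorem pairFold_perm (hb : ∀ i j x, b i j x = b j i x)
    (hbb : ∀ i j k m x, b j m (b k i x) = b i m (b k j x))
    (hb₁ : ∀ i j k x, e₁ j (b k i x) = e₁ i (b k j x))
    {l l' : List ℕ} (hl : l.Perm l') (x : M) :
    pairFold b e₀ e₁ l x = pairFold b e₀ e₁ l' x := by
  -- A prefix of odd length shifts the pairing, so the induction must allow every prefix.
  suffices ∀ p : List ℕ, pairFold b e₀ e₁ (p ++ l) x = pairFold b e₀ e₁ (p ++ l') x from this []
  induction hl with
  | nil => intro; rfl
  | cons a _ ih => intro p; simpa using ih (p ++ [a])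
  | swap i j l => intro p; exact pairFold_swap hb hbb hb₁ j i p l x
  | trans _ _ ih ih' => intro p; rw [ih, ih']

end PairFold

/-- A prefix of even length does not shift the pairing; the value `e` for a left-over entry of the
prefix is never reached. -/
theorem pairFold_append {M N : Type*} {b : ℕ → ℕ → M → M} {e₀ : M → N} {e₁ : ℕ → M → N}
    (e : ℕ → M → M) (l : List ℕ) :
    ∀ t : List ℕ, Even t.length → ∀ x : M,
      pairFold b e₀ e₁ (t ++ l) x = pairFold b e₀ e₁ l (pairFold b id e t x)
  | [], _, _ => rfl
  | [_], h, _ => by simp at h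
  | i :: j :: t, h, x => by
    have h' : Even t.length := by simpa [Nat.even_add_one] using h
    exact pairFold_append e l t h' (b i j x)

/-! ### Words -/

section Words
variable {K F : Type*} [Field K] [NonAssocCommRing F] [Module K F] {F₀ F₁ : Submodule K F}

/-- Successive left multiplications. -/
def leftMuls (f : ℕ → F) (l : List ℕ) (x : F) : F :=
  l.foldr (fun i x => f i * x) x

theorem leftMuls_cons (f : ℕ → F) (i : ℕ) (l : List ℕ) (x : F) :
    leftMuls f (i :: l) x = f i * leftMuls f l x := rfl

theorem leftMuls_perm {f : ℕ → F} (hf : ∀ i j x, f i * (f j * x) = f j * (f i * x))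
    {l l' : List ℕ} (h : l.Perm l') (x : F) : leftMuls f l x = leftMuls f l' x := by
  have : LeftCommutative fun (i : ℕ) (x : F) => f i * x := ⟨hf⟩
  exact h.foldr_eq x

/-- The words in the even generators. -/
inductive EvenVarWord (y : ℕ → F) : List ℕ → F → Prop
  | one : EvenVarWord y [] 1
  | mul (i : ℕ) {s u} : EvenVarWord y s u → EvenVarWord y (i :: s) (y i * u)

/-- The odd words, with the lists of generators they are composed of: the even generators that
act by multiplication, those that act in pairs by associators, and the odd generators. -/
inductive OddWord (y z : ℕ → F) : List ℕ → List ℕ → List ℕ → F → Prop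
  | of (k : ℕ) : OddWord y z [] [] [k] (z k)
  | mul (i : ℕ) {s t m w} : OddWord y z s t m w → OddWord y z (i :: s) t m (y i * w)
  | assoc (i j : ℕ) {s t m w} : OddWord y z s t m w →
      OddWord y z s (i :: j :: t) m (associator (y i) (y j) w)
  | mul_odd (i j : ℕ) {s t m w} : OddWord y z s t m w →
      OddWord y z s t (i :: j :: m) ((z i * z j) * w)

/-- The even words that contain odd generators. -/
inductive EvenWord (y z : ℕ → F) : List ℕ → List ℕ → List ℕ → F → Prop
  | mul (k : ℕ) {s t m w} : OddWord y z s t m w → EvenWord y z s t (k :: m) (w * z k)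
  | assoc (j k : ℕ) {s t m w} : OddWord y z s t m w →
      EvenWord y z s (j :: t) (k :: m) (-associator (y j) w (z k))

/-- The operator on `F₁` attached to the list of even generators that act by associators. -/
def pairOp (y : ℕ → F) : List ℕ → F → F :=
  pairFold (fun i j x => associator (y i) (y j) x) id (fun _ x => x - x)

/-- The operator from `F₁` to `F₀` attached to the list of even generators that act by
associators. -/
def pairOpMul (y : ℕ → F) (z : F) : List ℕ → F → F :=
  pairFold (fun i j x => associator (y i) (y j) x) (fun x => x * z)
    (fun i x => -associator (y i) x z)

variable {y z : ℕ → F}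

theorem EvenVarWord.eq {s : List ℕ} {u : F} (hu : EvenVarWord y s u) : u = leftMuls y s 1 := by
  induction hu with
  | one => rfl
  | mul i _ ih => rw [ih]; rfl

theorem EvenVarWord.mem (h : BasisLaws F₀ F₁) (hy : ∀ i, y i ∈ F₀) {s : List ℕ} {u : F}
    (hu : EvenVarWord y s u) : u ∈ F₀ := by
  induction hu with
  | one => exact h.one_mem
  | mul i _ ih => exact h.mul_mem₀₀ (hy i) ih

theorem OddWord.mem (h : BasisLaws F₀ F₁) (hy : ∀ i, y i ∈ F₀) (hz : ∀ i, z i ∈ F₁)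
    {s t m : List ℕ} {w : F} (hw : OddWord y z s t m w) : w ∈ F₁ := by
  induction hw with
  | of k => exact hz k
  | mul i _ ih => exact h.mul_mem₀₁ (hy i) ih
  | assoc i j _ ih => exact h.assoc_even_mem (hy i) (hy j) _
  | mul_odd i j _ ih => exact h.mul_mem₀₁ (h.mul_mem₁₁ (hz i) (hz j)) ih

theorem OddWord.even_length {s t m : List ℕ} {w : F} (hw : OddWord y z s t m w) :
    Even t.length := by
  induction hw with
  | of k => simp
  | mul i _ ih => exact ih
  | assoc i j _ ih => simpa [Nat.even_add_one] using ih
  | mul_odd i j _ ih => exact ih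

theorem OddWord.odd_length {s t m : List ℕ} {w : F} (hw : OddWord y z s t m w) :
    Odd m.length := by
  induction hw with
  | of k => simp
  | mul i _ ih => exact ih
  | assoc i j _ ih => exact ih
  | mul_odd i j _ ih => simpa [Nat.odd_add_one] using ih

/-! ### Closed formulas for the words -/

theorem evenOp_leftMuls (hy : ∀ i, y i ∈ F₀) (s : List ℕ) : EvenOp F₀ (leftMuls y s) := by
  induction s with
  | nil => exact .id
  | cons i s ih => exact .mul (hy i) ih

theorem evenOp_pairOp (h : BasisLaws F₀ F₁) (hy : ∀ i, y i ∈ F₀) :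
    ∀ (t : List ℕ) {P : F → F}, EvenOp F₀ P → EvenOp F₀ fun x => pairOp y t (P x)
  | [], _, hP => hP
  -- Lists of odd length do not occur in odd words; their default value `x - x` is written as a
  -- difference so that it stays among the generated operators.
  | [_], _, hP => hP.sub hP
  | i :: j :: t, _, hP => evenOp_pairOp h hy t (hP.assoc h (hy i) (hy j))

theorem pairOp_perm (h : BasisLaws F₀ F₁) (hy : ∀ i, y i ∈ F₀) {t t' : List ℕ}
    (ht : t.Perm t') (x : F) : pairOp y t x = pairOp y t' x :=
  pairFold_perm (fun i j => h.assoc_symm (hy i) (hy j))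
    (fun i j k m => h.assoc_assoc_even (hy k) (hy j) (hy i)) (fun _ _ _ _ => by simp) ht x

theorem pairOpMul_perm (h : BasisLaws F₀ F₁) (hy : ∀ i, y i ∈ F₀) {z : F} (hz : z ∈ F₁)
    {t t' : List ℕ} (ht : t.Perm t') (x : F) : pairOpMul y z t x = pairOpMul y z t' x :=
  pairFold_perm (fun i j => h.assoc_symm (hy i) (hy j))
    (fun i j k m => h.assoc_assoc_even (hy k) (hy j) (hy i))
    (fun i j k x => by simp only [h.assoc_assoc_odd (hy k) (hy j) (hy i) hz]) ht x

/-- An even word singles out one odd generator as its last factor; this exchanges it with one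
inside. When an entry is left over, both products in the final associator are exchanged by
`EvenOp.exchange`. -/
theorem pairOpMul_exchange (h : BasisLaws F₀ F₁) (hy : ∀ i, y i ∈ F₀) {w w' g : F} (hw : w ∈ F₁)
    (hw' : w' ∈ F₁) (hg : g ∈ F₀) (hc : ∀ x x', x * (g * x') = g * (x * x')) :
    ∀ (t : List ℕ) {P : F → F}, EvenOp F₀ P →
      pairOpMul y w t (P (w' * g)) = pairOpMul y w' t (P (w * g))
  | [], _, hP => hP.exchange h hw hw' hg hc
  | [i], P, hP => by
    have e := (EvenOp.mul (hy i) hP).exchange h hw hw' hg hc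
    simp only [pairOpMul, pairFold, associator, hP.exchange h hw hw' hg hc, e]
  | i :: j :: t, _, hP =>
    pairOpMul_exchange h hy hw hw' hg hc t (hP.assoc h (hy i) (hy j))

/-- The claims are proved together: adding two generators to `m` multiplies two odd elements, to
which `central` applies. -/
theorem leftMuls_odd (h : BasisLaws F₀ F₁) (hz : ∀ i, z i ∈ F₁) :
    ∀ m : List ℕ, Even m.length →
      leftMuls z m 1 ∈ F₀ ∧ (∀ k, leftMuls z (k :: m) 1 ∈ F₁) ∧
        ∀ x x', x * (leftMuls z m 1 * x') = leftMuls z m 1 * (x * x')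
  | [], _ => ⟨h.one_mem, fun k => by simpa [leftMuls] using hz k, by simp [leftMuls]⟩
  | [_], hm => by simp at hm
  | i :: j :: m, hm => by
    have hm' : Even m.length := by simpa [Nat.even_add_one] using hm
    have hj := (leftMuls_odd h hz m hm').2.1 j
    have hij := h.mul_mem₁₁ (hz i) hj
    exact ⟨hij, fun k => by
      rw [leftMuls_cons, mul_comm]; exact h.mul_mem₀₁ hij (hz k), h.central (hz i) hj⟩

/-- Since all operations commute, the associators can be collected outermost, the even
multiplications below them and the odd generators innermost. -/
theorem OddWord.eq (h : BasisLaws F₀ F₁) (hy : ∀ i, y i ∈ F₀) (hz : ∀ i, z i ∈ F₁)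
    {s t m : List ℕ} {w : F} (hw : OddWord y z s t m w) :
    w = pairOp y t (leftMuls y s (leftMuls z m 1)) := by
  have hP := fun t s => evenOp_pairOp h hy t (evenOp_leftMuls hy s)
  induction hw with
  | of k => simp [pairOp, pairFold, leftMuls]
  | @mul i s t m w _ ih =>
    have e := (hP t []).comm h (hy i) (leftMuls y s (leftMuls z m 1))
    rw [ih, leftMuls_cons]
    exact e.symm
  | @assoc i j s t m w _ ih =>
    rw [ih]
    exact ((EvenOp.id (F₀ := F₀)).assoc h (hy i) (hy j)).comm_op h (hP t []) _
  | @mul_odd i j s t m w hw ih =>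
    have hm := hw.odd_length
    have hg : leftMuls z m 1 ∈ F₁ := by
      cases m with
      | nil => simp at hm
      | cons k m => exact (leftMuls_odd h hz m (by simpa [Nat.odd_add_one] using hm)).2.1 k
    have e := (hP t s).comm h (h.mul_mem₁₁ (hz i) (hz j)) (leftMuls z m 1)
    rw [ih]
    refine e.symm.trans ?_
    -- For odd `g`, `(z_i z_j) g = (g z_j) z_i = z_i (z_j g)`.
    rw [h.odd_mul_assoc (hz i) (hz j) hg, mul_comm, mul_comm _ (z j)]
    rfl

theorem EvenWord.eq (h : BasisLaws F₀ F₁) (hy : ∀ i, y i ∈ F₀) (hz : ∀ i, z i ∈ F₁)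
    {s t m : List ℕ} {e : F} (he : EvenWord y z s t m e) :
    ∃ k m', m = k :: m' ∧ Odd m'.length ∧
      e = pairOpMul y (z k) t (leftMuls y s (leftMuls z m' 1)) := by
  cases he with
  | @mul k _ _ m w hw =>
    refine ⟨k, m, rfl, hw.odd_length, ?_⟩
    rw [hw.eq h hy hz]
    have := pairFold_append (b := fun i j x => associator (y i) (y j) x) (e₀ := fun x => x * z k)
      (e₁ := fun i x => -associator (y i) x (z k)) (fun _ x => x - x) [] t hw.even_length
      (leftMuls y s (leftMuls z m 1))
    rw [List.append_nil] at this
    exact this.symm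
  | @assoc j k _ t m w hw =>
    refine ⟨k, m, rfl, hw.odd_length, ?_⟩
    have := pairFold_append (b := fun i j x => associator (y i) (y j) x) (e₀ := fun x => x * z k)
      (e₁ := fun i x => -associator (y i) x (z k)) (fun _ x => x - x) [j] t hw.even_length
      (leftMuls y s (leftMuls z m 1))
    -- `EvenWord.assoc` lists its unpaired generator first, whereas `pairFold` leaves over the last
    -- entry.
    rw [hw.eq h hy hz, pairOpMul_perm h hy (hz k) (List.perm_append_singleton j t).symm]
    exact this.symm

/-! ### A word is determined by its generators -/

theorem BasisLaws.leftMuls_even_perm (h : BasisLaws F₀ F₁) (hy : ∀ i, y i ∈ F₀) {l l' : List ℕ}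
    (hl : l.Perm l') (x : F) : leftMuls y l x = leftMuls y l' x :=
  leftMuls_perm (fun i j => h.comm₀ (hy i) (hy j)) hl x

theorem BasisLaws.leftMuls_odd_perm (h : BasisLaws F₀ F₁) (hz : ∀ i, z i ∈ F₁) {l l' : List ℕ}
    (hl : l.Perm l') (x : F) : leftMuls z l x = leftMuls z l' x :=
  leftMuls_perm (fun i j => h.comm₁ (hz i) (hz j)) hl x

theorem EvenVarWord.unique (h : BasisLaws F₀ F₁) (hy : ∀ i, y i ∈ F₀) {s s' : List ℕ} {u u' : F}
    (hu : EvenVarWord y s u) (hu' : EvenVarWord y s' u') (hs : s.Perm s') : u = u' := by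
  rw [hu.eq, hu'.eq, h.leftMuls_even_perm hy hs]

theorem OddWord.unique (h : BasisLaws F₀ F₁) (hy : ∀ i, y i ∈ F₀) (hz : ∀ i, z i ∈ F₁)
    {s t m s' t' m' : List ℕ} {w w' : F} (hw : OddWord y z s t m w)
    (hw' : OddWord y z s' t' m' w') (hs : s.Perm s') (ht : t.Perm t') (hm : m.Perm m') :
    w = w' := by
  rw [hw.eq h hy hz, hw'.eq h hy hz, pairOp_perm h hy ht, h.leftMuls_even_perm hy hs,
    h.leftMuls_odd_perm hz hm]

/-- If the singled-out odd generators `k` and `k'` differ, the remaining ones are `k' :: c` and `k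
:: c` up to order, with `c` of even length; the product over `c` passes through every
multiplication, so `k` and `k'` can be exchanged. -/
theorem EvenWord.unique (h : BasisLaws F₀ F₁) (hy : ∀ i, y i ∈ F₀) (hz : ∀ i, z i ∈ F₁)
    {s t m s' t' m' : List ℕ} {e e' : F} (he : EvenWord y z s t m e)
    (he' : EvenWord y z s' t' m' e') (hs : s.Perm s') (ht : t.Perm t') (hm : m.Perm m') :
    e = e' := by
  obtain ⟨k, m, rfl, hmo, rfl⟩ := he.eq h hy hz
  obtain ⟨k', m', rfl, -, rfl⟩ := he'.eq h hy hz
  rw [pairOpMul_perm h hy (hz k) ht, h.leftMuls_even_perm hy hs]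
  rw [← Multiset.coe_eq_coe, ← Multiset.cons_coe, ← Multiset.cons_coe,
    Multiset.cons_eq_cons] at hm
  obtain ⟨rfl, hm⟩ | ⟨-, c, hc, hc'⟩ := hm
  · rw [h.leftMuls_odd_perm hz (Multiset.coe_eq_coe.1 hm)]
  · induction c using Quotient.inductionOn with | _ c
    have p : m.Perm (k' :: c) := Multiset.coe_eq_coe.1 hc
    have p' : m'.Perm (k :: c) := Multiset.coe_eq_coe.1 hc'
    have hcl : Even c.length := by simpa [p.length_eq, Nat.odd_add_one] using hmo
    obtain ⟨hg, -, hgc⟩ := leftMuls_odd h hz c hcl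
    rw [h.leftMuls_odd_perm hz p, h.leftMuls_odd_perm hz p', leftMuls_cons, leftMuls_cons]
    exact pairOpMul_exchange h hy (hz k) (hz k') hg hgc t' (evenOp_leftMuls hy s')

end Words

/-! ### The span of the words is closed under multiplication -/

namespace BasisLaws
variable {K F : Type*} [Field K] [NonAssocCommRing F] [Module K F] {F₀ F₁ : Submodule K F}

/-- This is identity 2 rewritten by self-adjointness. It moves an even multiplication inside the
associator at the cost of a product of two odd elements. -/
theorem mul_assoc_odd (h : BasisLaws F₀ F₁) {u v w w' : F} (hu : u ∈ F₀) (hv : v ∈ F₀)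
    (hw : w ∈ F₁) (hw' : w' ∈ F₁) :
    u * associator v w w' = associator v (u * w) w' - associator u v w * w' := by
  have e := h.assoc_mul_odd hu hv hw hw'
  have e₁ : w * ((w' * u) * v) = (u * (v * w)) * w' := by
    rw [mul_comm w' u, mul_comm _ v, h.adjoint hw (h.mul_mem₀₁ hu hw'),
      h.adjoint (h.mul_mem₀₁ hv hw) hw']
  have e₂ : w * (w' * (u * v)) = ((u * v) * w) * w' := by
    rw [mul_comm w', h.adjoint hw hw']
  have e₃ : (u * v) * (w * w') = u * (v * (w * w')) :=
    h.even_assoc hu hv (h.mul_mem₁₁ hw hw')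
  simp only [associator, mul_sub, sub_mul, e₁, e₂, e₃, h.comm₀ hv hu] at e ⊢
  linear_combination (norm := module) -e

/-- In `J` this associator is a multiple of `a`, and `ab = 0`. Here both of its terms, multiplied by
`w'`, become `v ((w' z) w)`. -/
theorem assoc_odd_mul (h : BasisLaws F₀ F₁) {v w z w' : F} (hv : v ∈ F₀) (hw : w ∈ F₁)
    (hz : z ∈ F₁) (hw' : w' ∈ F₁) : associator v w z * w' = 0 := by
  have e := h.assoc_odd_mul_odd hw hz v w'
  rw [associator, sub_eq_zero] at e
  rw [associator, sub_mul, h.odd_mul_assoc (h.mul_mem₀₁ hv hw) hz hw',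
    h.comm₀ (h.mul_mem₁₁ hw' hz) hv, mul_comm v (w * z), e, h.comm₀ (h.mul_mem₁₁ hw hz) hv,
    h.odd_mul_assoc hw hz hw', sub_self]

theorem mul_odd_assoc (h : BasisLaws F₀ F₁) {w z x x' : F} (hw : w ∈ F₁) (hz : z ∈ F₁) :
    (w * z) * (x * x') = ((w * z) * x) * x' := by
  have e := h.assoc_odd_mul_odd hw hz x x'
  rw [associator, sub_eq_zero] at e
  exact e.symm

end BasisLaws

section Span
set_option linter.unusedSectionVars false
variable {K F : Type*} [Field K] [NonAssocCommRing F] [Module K F] {F₀ F₁ : Submodule K F}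
variable (K) (y z : ℕ → F)

/-- The span of the words in the even generators. -/
def evenVarSpan : Submodule K F := Submodule.span K {u | ∃ s, EvenVarWord y s u}

/-- The span of the odd words. -/
def oddSpan : Submodule K F := Submodule.span K {w | ∃ s t m, OddWord y z s t m w}

/-- The span of the even words that contain odd generators. -/
def evenSpan : Submodule K F := Submodule.span K {e | ∃ s t m, EvenWord y z s t m e}

variable {K y z}

theorem oddSpan_le (h : BasisLaws F₀ F₁) (hy : ∀ i, y i ∈ F₀) (hz : ∀ i, z i ∈ F₁) :
    oddSpan K y z ≤ F₁ :=
  Submodule.span_le.2 fun _ ⟨_, _, _, hw⟩ => hw.mem h hy hz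

theorem evenSpan_le (h : BasisLaws F₀ F₁) (hy : ∀ i, y i ∈ F₀) (hz : ∀ i, z i ∈ F₁) :
    evenSpan K y z ≤ F₀ := by
  refine Submodule.span_le.2 ?_
  rintro _ ⟨_, _, _, he⟩
  cases he with
  | mul k hw => exact h.mul_mem₁₁ (hw.mem h hy hz) (hz k)
  | assoc j k hw =>
    have hw := hw.mem h hy hz
    exact F₀.neg_mem (F₀.sub_mem (h.mul_mem₁₁ (h.mul_mem₀₁ (hy j) hw) (hz k))
      (h.mul_mem₀₀ (hy j) (h.mul_mem₁₁ hw (hz k))))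

theorem mem_of_mem_span {S : Set F} {T : Submodule K F} (f : F →ₗ[K] F) {w : F}
    (hw : w ∈ Submodule.span K S) (hf : ∀ w ∈ S, f w ∈ T) : f w ∈ T :=
  (Submodule.span_le.2 hf : Submodule.span K S ≤ T.comap f) hw

variable [IsScalarTower K F F] [SMulCommClass K F F]

/-- The associator as a linear map of its third argument. -/
def assocLinear (K : Type*) {F : Type*} [Field K] [NonAssocCommRing F] [Module K F]
    [IsScalarTower K F F] [SMulCommClass K F F] (u v : F) : F →ₗ[K] F :=
  LinearMap.mulLeft K (u * v) - LinearMap.mulLeft K u ∘ₗ LinearMap.mulLeft K v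

/-- The associator as a linear map of its second argument. -/
def assocLinear₂ (K : Type*) {F : Type*} [Field K] [NonAssocCommRing F] [Module K F]
    [IsScalarTower K F F] [SMulCommClass K F F] (u v : F) : F →ₗ[K] F :=
  LinearMap.mulRight K v ∘ₗ LinearMap.mulLeft K u - LinearMap.mulLeft K u ∘ₗ LinearMap.mulRight K v

/-! ### Products of elements of the spans -/

theorem mul_mem_oddSpan (i : ℕ) {w : F} (hw : w ∈ oddSpan K y z) : y i * w ∈ oddSpan K y z :=
  mem_of_mem_span (LinearMap.mulLeft K (y i)) hw
    fun _ ⟨_, _, _, hw⟩ => Submodule.subset_span ⟨_, _, _, hw.mul i⟩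

theorem assoc_mem_oddSpan (i j : ℕ) {w : F} (hw : w ∈ oddSpan K y z) :
    associator (y i) (y j) w ∈ oddSpan K y z :=
  mem_of_mem_span (assocLinear K (y i) (y j)) hw
    fun _ ⟨_, _, _, hw⟩ => Submodule.subset_span ⟨_, _, _, hw.assoc i j⟩

theorem mul_odd_mem_oddSpan (i j : ℕ) {w : F} (hw : w ∈ oddSpan K y z) :
    (z i * z j) * w ∈ oddSpan K y z :=
  mem_of_mem_span (LinearMap.mulLeft K (z i * z j)) hw
    fun _ ⟨_, _, _, hw⟩ => Submodule.subset_span ⟨_, _, _, hw.mul_odd i j⟩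

theorem mul_mem_evenSpan (k : ℕ) {w : F} (hw : w ∈ oddSpan K y z) :
    w * z k ∈ evenSpan K y z :=
  mem_of_mem_span (LinearMap.mulRight K (z k)) hw
    fun _ ⟨_, _, _, hw⟩ => Submodule.subset_span ⟨_, _, _, .mul k hw⟩

theorem assoc_mem_evenSpan (j k : ℕ) {w : F} (hw : w ∈ oddSpan K y z) :
    associator (y j) w (z k) ∈ evenSpan K y z := by
  rw [← neg_mem_iff]
  exact mem_of_mem_span (-assocLinear₂ K (y j) (z k)) hw
    fun _ ⟨_, _, _, hw⟩ => Submodule.subset_span ⟨_, _, _, .assoc j k hw⟩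

/-- Write `(y_i u) w = (y_i, u, w) + y_i (u w)`. The associator is handled by the second statement,
whose own induction is identity 3, a Leibniz rule in the first argument. -/
theorem EvenVarWord.mul_mem_oddSpan (h : BasisLaws F₀ F₁) (hy : ∀ i, y i ∈ F₀)
    (hz : ∀ i, z i ∈ F₁) {s : List ℕ} {u : F} (hu : EvenVarWord y s u) :
    (∀ w ∈ oddSpan K y z, u * w ∈ oddSpan K y z) ∧
      ∀ j, ∀ w ∈ oddSpan K y z, associator u (y j) w ∈ oddSpan K y z := by
  induction hu with
  | one => simp [associator]
  | @mul i s u hu ih =>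
    have hu := hu.mem h hy
    refine ⟨fun w hw => ?_, fun j w hw => ?_⟩
    · rw [← sub_add_cancel ((y i * u) * w) (y i * (u * w)), ← associator,
        h.assoc_symm (hy i) hu]
      exact add_mem (ih.2 i w hw) (_root_.mul_mem_oddSpan i (ih.1 w hw))
    · rw [h.assoc_mul_even (hy i) hu (hy j) (oddSpan_le h hy hz hw)]
      exact add_mem (_root_.mul_mem_oddSpan i (ih.2 j w hw)) (ih.1 _ (assoc_mem_oddSpan i j hw))

/-- Use `y_i (w z_k) = (y_i w) z_k - (y_i, w, z_k)` and, for words ending in an associator,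
`mul_assoc_odd`. -/
theorem var_mul_mem_evenSpan (h : BasisLaws F₀ F₁) (hy : ∀ i, y i ∈ F₀) (hz : ∀ i, z i ∈ F₁)
    (i : ℕ) {e : F} (he : e ∈ evenSpan K y z) : y i * e ∈ evenSpan K y z := by
  refine mem_of_mem_span (LinearMap.mulLeft K (y i)) he ?_
  rintro _ ⟨_, _, _, he⟩
  rw [LinearMap.mulLeft_apply]
  cases he with
  | @mul k _ _ _ w hw =>
    have hw : w ∈ oddSpan K y z := Submodule.subset_span ⟨_, _, _, hw⟩
    rw [← sub_sub_self ((y i * w) * z k) (y i * (w * z k)), ← associator]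
    exact sub_mem (mul_mem_evenSpan k (mul_mem_oddSpan i hw)) (assoc_mem_evenSpan i k hw)
  | @assoc j k _ _ _ w hw =>
    have hw : w ∈ oddSpan K y z := Submodule.subset_span ⟨_, _, _, hw⟩
    rw [mul_neg, neg_mem_iff, h.mul_assoc_odd (hy i) (hy j) (oddSpan_le h hy hz hw) (hz k)]
    exact sub_mem (assoc_mem_evenSpan j k (mul_mem_oddSpan i hw))
      (mul_mem_evenSpan k (assoc_mem_oddSpan i j hw))

theorem EvenVarWord.mul_mem_evenSpan (h : BasisLaws F₀ F₁) (hy : ∀ i, y i ∈ F₀)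
    (hz : ∀ i, z i ∈ F₁) {s : List ℕ} {u : F} (hu : EvenVarWord y s u) {e : F}
    (he : e ∈ evenSpan K y z) : u * e ∈ evenSpan K y z := by
  induction hu with
  | one => rwa [one_mul]
  | mul i hu ih =>
    rw [h.even_assoc (hy i) (hu.mem h hy) (evenSpan_le h hy hz he)]
    exact var_mul_mem_evenSpan h hy hz i ih

theorem EvenVarWord.mul_mem_evenVarSpan (h : BasisLaws F₀ F₁) (hy : ∀ i, y i ∈ F₀) {s : List ℕ}
    {u : F} (hu : EvenVarWord y s u) {v : F} (hv : v ∈ evenVarSpan K y) :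
    u * v ∈ evenVarSpan K y := by
  have hle : evenVarSpan K y ≤ F₀ := Submodule.span_le.2 fun _ ⟨_, hu⟩ => hu.mem h hy
  induction hu with
  | one => rwa [one_mul]
  | mul i hu ih =>
    rw [h.even_assoc (hy i) (hu.mem h hy) (hle hv)]
    exact mem_of_mem_span (LinearMap.mulLeft K (y i)) ih
      fun _ ⟨_, hw⟩ => Submodule.subset_span ⟨_, hw.mul i⟩

/-- Each operation that builds `w'` is self-adjoint, so it can be moved onto `w` until only a
generator `z_k` is left. -/
theorem odd_mul_odd_mem_evenSpan (h : BasisLaws F₀ F₁) (hy : ∀ i, y i ∈ F₀) (hz : ∀ i, z i ∈ F₁)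
    {w w' : F} (hw : w ∈ oddSpan K y z) (hw' : w' ∈ oddSpan K y z) :
    w * w' ∈ evenSpan K y z := by
  refine mem_of_mem_span (LinearMap.mulLeft K w) hw' ?_
  rintro v ⟨_, _, _, hv⟩
  rw [LinearMap.mulLeft_apply]
  induction hv generalizing w with
  | of k => exact mul_mem_evenSpan k hw
  | mul i hv ih =>
    rw [h.adjoint (oddSpan_le h hy hz hw) (hv.mem h hy hz)]
    exact ih (mul_mem_oddSpan i hw)
  | assoc i j hv ih =>
    have e := (EvenOp.assoc h (hy i) (hy j) .id).adjoint h (oddSpan_le h hy hz hw)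
      (hv.mem h hy hz)
    exact e ▸ ih (assoc_mem_oddSpan i j hw)
  | mul_odd i j hv ih =>
    rw [h.adjoint (oddSpan_le h hy hz hw) (hv.mem h hy hz)]
    exact ih (mul_odd_mem_oddSpan i j hw)

/-- The even element `w z_k` commutes with every operation that builds `w'`, and `(w z_k) z_i = (z_i
z_k) w`. -/
theorem odd_mul_var_mul_mem_oddSpan (h : BasisLaws F₀ F₁) (hy : ∀ i, y i ∈ F₀)
    (hz : ∀ i, z i ∈ F₁) (k : ℕ) {w w' : F} (hw : w ∈ oddSpan K y z)
    (hw' : w' ∈ oddSpan K y z) : (w * z k) * w' ∈ oddSpan K y z := by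
  refine mem_of_mem_span (LinearMap.mulLeft K (w * z k)) hw' ?_
  rintro v ⟨_, _, _, hv⟩
  have hw₁ := oddSpan_le h hy hz hw
  have hc := h.mul_mem₁₁ hw₁ (hz k)
  rw [LinearMap.mulLeft_apply]
  induction hv with
  | of i =>
    rw [h.odd_mul_assoc hw₁ (hz k) (hz i)]
    exact mul_odd_mem_oddSpan i k hw
  | mul i hv ih =>
    rw [h.comm₀ hc (hy i)]
    exact mul_mem_oddSpan i ih
  | assoc i j hv ih =>
    have e := (EvenOp.assoc h (hy i) (hy j) .id).comm h hc
    exact (e _) ▸ assoc_mem_oddSpan i j ih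
  | mul_odd i j hv ih =>
    rw [h.comm₀ hc (h.mul_mem₁₁ (hz i) (hz j))]
    exact mul_odd_mem_oddSpan i j ih

theorem even_mul_odd_mem_oddSpan (h : BasisLaws F₀ F₁) (hy : ∀ i, y i ∈ F₀) (hz : ∀ i, z i ∈ F₁)
    {e w : F} (he : e ∈ evenSpan K y z) (hw : w ∈ oddSpan K y z) : e * w ∈ oddSpan K y z := by
  refine mem_of_mem_span (LinearMap.mulRight K w) he ?_
  rintro _ ⟨_, _, _, he⟩
  rw [LinearMap.mulRight_apply]
  cases he with
  | mul k hv =>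
    exact odd_mul_var_mul_mem_oddSpan h hy hz k (Submodule.subset_span ⟨_, _, _, hv⟩) hw
  | assoc j k hv =>
    rw [neg_mul, h.assoc_odd_mul (hy j) (hv.mem h hy hz) (hz k) (oddSpan_le h hy hz hw), neg_zero]
    exact zero_mem _

/-- By identity 4 the factor `w z_k` can be absorbed into the odd word inside `e`. -/
theorem odd_mul_var_mul_mem_evenSpan (h : BasisLaws F₀ F₁) (hy : ∀ i, y i ∈ F₀)
    (hz : ∀ i, z i ∈ F₁) (k : ℕ) {w e : F} (hw : w ∈ oddSpan K y z)
    (he : e ∈ evenSpan K y z) : (w * z k) * e ∈ evenSpan K y z := by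
  refine mem_of_mem_span (LinearMap.mulLeft K (w * z k)) he ?_
  rintro _ ⟨_, _, _, he⟩
  have hw₁ := oddSpan_le h hy hz hw
  have hc := h.mul_mem₁₁ hw₁ (hz k)
  rw [LinearMap.mulLeft_apply]
  cases he with
  | mul l hv =>
    rw [h.mul_odd_assoc hw₁ (hz k)]
    exact mul_mem_evenSpan l
      (odd_mul_var_mul_mem_oddSpan h hy hz k hw (Submodule.subset_span ⟨_, _, _, hv⟩))
  | @assoc j l _ _ _ v hv =>
    have e : (w * z k) * associator (y j) v (z l) =
        associator (y j) ((w * z k) * v) (z l) := by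
      simp only [associator]
      rw [mul_sub, h.mul_odd_assoc hw₁ (hz k), h.comm₀ hc (hy j), h.comm₀ hc (hy j),
        h.mul_odd_assoc hw₁ (hz k) (x := v)]
    rw [mul_neg, neg_mem_iff, e]
    exact assoc_mem_evenSpan j l
      (odd_mul_var_mul_mem_oddSpan h hy hz k hw (Submodule.subset_span ⟨_, _, _, hv⟩))

theorem even_mul_even_mem_evenSpan (h : BasisLaws F₀ F₁) (hy : ∀ i, y i ∈ F₀)
    (hz : ∀ i, z i ∈ F₁) {e e' : F} (he : e ∈ evenSpan K y z) (he' : e' ∈ evenSpan K y z) :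
    e * e' ∈ evenSpan K y z := by
  refine mem_of_mem_span (LinearMap.mulRight K e') he ?_
  rintro _ ⟨_, _, _, he⟩
  rw [LinearMap.mulRight_apply]
  cases he with
  | mul k hv =>
    exact odd_mul_var_mul_mem_evenSpan h hy hz k (Submodule.subset_span ⟨_, _, _, hv⟩) he'
  | @assoc j k _ _ _ v hv =>
    have hv₁ := hv.mem h hy hz
    have hv : v ∈ oddSpan K y z := Submodule.subset_span ⟨_, _, _, hv⟩
    rw [neg_mul, neg_mem_iff, associator, sub_mul,
      h.even_assoc (hy j) (h.mul_mem₁₁ hv₁ (hz k)) (evenSpan_le h hy hz he')]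
    exact sub_mem (odd_mul_var_mul_mem_evenSpan h hy hz k (mul_mem_oddSpan j hv) he')
      (var_mul_mem_evenSpan h hy hz j (odd_mul_var_mul_mem_evenSpan h hy hz k hv he'))

theorem mul_mem_span_words (h : BasisLaws F₀ F₁) (hy : ∀ i, y i ∈ F₀) (hz : ∀ i, z i ∈ F₁)
    {x x' : F} (hx : x ∈ evenVarSpan K y ⊔ oddSpan K y z ⊔ evenSpan K y z)
    (hx' : x' ∈ evenVarSpan K y ⊔ oddSpan K y z ⊔ evenSpan K y z) :
    x * x' ∈ evenVarSpan K y ⊔ oddSpan K y z ⊔ evenSpan K y z := by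
  have hY : evenVarSpan K y ≤ evenVarSpan K y ⊔ oddSpan K y z ⊔ evenSpan K y z :=
    le_sup_left.trans le_sup_left
  have hO : oddSpan K y z ≤ evenVarSpan K y ⊔ oddSpan K y z ⊔ evenSpan K y z :=
    le_sup_right.trans le_sup_left
  have hE : evenSpan K y z ≤ evenVarSpan K y ⊔ oddSpan K y z ⊔ evenSpan K y z := le_sup_right
  have yo : ∀ {u w}, u ∈ evenVarSpan K y → w ∈ oddSpan K y z → u * w ∈ oddSpan K y z :=
    fun {u w} hu hw => mem_of_mem_span (LinearMap.mulRight K w) hu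
      fun _ ⟨_, hu⟩ => (hu.mul_mem_oddSpan h hy hz).1 w hw
  have ye : ∀ {u e}, u ∈ evenVarSpan K y → e ∈ evenSpan K y z → u * e ∈ evenSpan K y z :=
    fun {u e} hu he => mem_of_mem_span (LinearMap.mulRight K e) hu
      fun _ ⟨_, hu⟩ => hu.mul_mem_evenSpan h hy hz he
  have yy : ∀ {u v}, u ∈ evenVarSpan K y → v ∈ evenVarSpan K y → u * v ∈ evenVarSpan K y :=
    fun {u v} hu hv => mem_of_mem_span (LinearMap.mulRight K v) hu
      fun _ ⟨_, hu⟩ => hu.mul_mem_evenVarSpan h hy hv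
  obtain ⟨_, hx₁, e, he, rfl⟩ := Submodule.mem_sup.1 hx
  obtain ⟨u, hu, w, hw, rfl⟩ := Submodule.mem_sup.1 hx₁
  obtain ⟨_, hx₁', e', he', rfl⟩ := Submodule.mem_sup.1 hx'
  obtain ⟨u', hu', w', hw', rfl⟩ := Submodule.mem_sup.1 hx₁'
  simp only [add_mul, mul_add]
  refine add_mem (add_mem (add_mem (add_mem (hY (yy hu hu')) (hO ?_)) (hE ?_))
    (add_mem (add_mem (hO (yo hu hw')) (hE (odd_mul_odd_mem_evenSpan h hy hz hw hw')))
      (hO (even_mul_odd_mem_oddSpan h hy hz he hw'))))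
    (add_mem (add_mem (hE (ye hu he')) (hO ?_))
      (hE (even_mul_even_mem_evenSpan h hy hz he he')))
  · exact mul_comm u' w ▸ yo hu' hw
  · exact mul_comm u' e ▸ ye hu' he
  · exact mul_comm e' w ▸ even_mul_odd_mem_oddSpan h hy hz he' hw

end Span

/-! ### Monomials of the free Jordan algebra -/

namespace FreeJordan
variable {K X : Type*} [Field K]

theorem monomial_one : monomial K X 1 = 1 := by
  rw [monomial, ← MonoidAlgebra.one_def, mk_one]

theorem monomial_mul (m m' : WithOne (FreeMagma X)) :
    monomial K X (m * m') = monomial K X m * monomial K X m' := by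
  rw [monomial, monomial, monomial, ← mk_mul, MonoidAlgebra.single_mul_single, mul_one]

theorem span_monomial : Submodule.span K (Set.range (monomial K X)) = ⊤ := by
  refine eq_top_iff.2 fun f _ => ?_
  obtain ⟨a, rfl⟩ := mk_surjective K X f
  induction a using MonoidAlgebra.induction_linear with
  | zero => exact zero_mem _
  | add a b ha hb => exact add_mem (ha trivial) (hb trivial)
  | single m c =>
    have : mk K X (MonoidAlgebra.single m c) = c • monomial K X m := by
      rw [monomial, ← mk_smul, MonoidAlgebra.smul_single, smul_eq_mul, mul_one]
    exact this ▸ Submodule.smul_mem _ c (Submodule.subset_span ⟨m, rfl⟩)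

theorem monomial_mem {V : FreeJordan K X → Prop} (h₁ : V 1) (hof : ∀ x, V (of K X x))
    (hmul : ∀ f g, V f → V g → V (f * g)) (m : WithOne (FreeMagma X)) : V (monomial K X m) := by
  induction m using WithOne.recOneCoe with
  | one => exact monomial_one (K := K) (X := X) ▸ h₁
  | coe m =>
    induction m with
    | ih1 x => exact hof x
    | ih2 m m' h h' =>
      have := hmul _ _ h h'
      rwa [← monomial_mul, ← WithOne.coe_mul] at this

/-- A subspace that contains `1` and the generators and is closed under multiplication is the
whole algebra. -/
theorem eq_top_of_mul_mem {V : Submodule K (FreeJordan K X)} (h₁ : 1 ∈ V)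
    (hof : ∀ x, of K X x ∈ V) (hmul : ∀ f g, f ∈ V → g ∈ V → f * g ∈ V) : V = ⊤ := by
  rw [eq_top_iff, ← span_monomial, Submodule.span_le]
  rintro _ ⟨m, rfl⟩
  exact monomial_mem (V := (· ∈ V)) h₁ hof hmul m

variable {B : Type*} [NonAssocCommRing B] [Module K B] [IsScalarTower K B B]
  [SMulCommClass K B B] [IsCommJordan B]

/-- Evaluation as a linear map. -/
noncomputable def liftLinear (σ : X → B) : FreeJordan K X →ₗ[K] B where
  toFun := lift σ
  map_add' := map_add _
  map_smul' := lift_smul σ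

theorem liftLinear_apply (σ : X → B) (f : FreeJordan K X) : liftLinear σ f = lift σ f := rfl

theorem lift_lift {Y : Type*} (σ : X → B) (τ : Y → FreeJordan K X) (f : FreeJordan K Y) :
    lift σ (lift τ f) = lift (fun x => lift σ (τ x)) f := by
  have : LinearMap.eqLocus (liftLinear σ ∘ₗ liftLinear τ) (liftLinear fun x => lift σ (τ x)) = ⊤ :=
    eq_top_of_mul_mem (by simp [LinearMap.mem_eqLocus, liftLinear_apply])
      (by simp [LinearMap.mem_eqLocus, liftLinear_apply, lift_of])
      (fun f g hf hg => by
        simp only [LinearMap.mem_eqLocus, liftLinear_apply, LinearMap.comp_apply, map_mul]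
          at hf hg ⊢
        rw [hf, hg])
  exact (LinearMap.mem_eqLocus (f := liftLinear σ ∘ₗ liftLinear τ)).1 (this ▸ Submodule.mem_top)

end FreeJordan

/-! ### Homogeneous components -/

namespace FreeGrJordan
variable {K : Type*} [Field K]

theorem wordParity_mul (m m' : WithOne (FreeMagma GrVar)) :
    wordParity (m * m') = wordParity m + wordParity m' := by
  induction m using WithOne.recOneCoe with
  | one => rw [one_mul]; exact (zero_add _).symm
  | coe m =>
    induction m' using WithOne.recOneCoe with
    | one => rw [mul_one]; exact (add_zero _).symm
    | coe m' => rfl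

theorem one_mem_component : (1 : FreeGrJordan K) ∈ component K 0 :=
  Submodule.subset_span ⟨1, rfl, FreeJordan.monomial_one.symm⟩

theorem of_mem_component (x : GrVar) : FreeJordan.of K GrVar x ∈ component K x.1 :=
  Submodule.subset_span ⟨_, rfl, rfl⟩

theorem mul_mem_component {p q : ZMod 2} {f g : FreeGrJordan K} (hf : f ∈ component K p)
    (hg : g ∈ component K q) : f * g ∈ component K (p + q) := by
  refine mem_of_mem_span (LinearMap.mulRight K g) hf ?_
  rintro _ ⟨m, rfl, rfl⟩
  refine mem_of_mem_span (LinearMap.mulLeft K (FreeJordan.monomial K GrVar m)) hg ?_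
  rintro _ ⟨m', rfl, rfl⟩
  exact Submodule.subset_span ⟨m * m', wordParity_mul m m', (FreeJordan.monomial_mul m m').symm⟩

theorem component_sup : component K 0 ⊔ component K 1 = ⊤ := by
  rw [eq_top_iff, ← FreeJordan.span_monomial, Submodule.span_le]
  rintro _ ⟨m, rfl⟩
  have h : ∀ p : ZMod 2, p = 0 ∨ p = 1 := by decide
  rcases h (wordParity m) with h | h
  · exact Submodule.mem_sup_left (Submodule.subset_span ⟨m, h, rfl⟩)
  · exact Submodule.mem_sup_right (Submodule.subset_span ⟨m, h, rfl⟩)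

theorem lift_mem {B : Type*} [NonAssocCommRing B] [IsCommJordan B] [Module K B]
    [IsScalarTower K B B] [SMulCommClass K B B] {𝒜 : ZMod 2 → Submodule K B} (h₁ : 1 ∈ 𝒜 0)
    (hmul : ∀ p q u v, u ∈ 𝒜 p → v ∈ 𝒜 q → u * v ∈ 𝒜 (p + q)) {σ : GrVar → B}
    (hσ : ∀ x, σ x ∈ 𝒜 x.1) {p : ZMod 2} {f : FreeGrJordan K} (hf : f ∈ component K p) :
    FreeJordan.lift σ f ∈ 𝒜 p := by
  refine (Submodule.span_le.2 ?_ : component K p ≤ (𝒜 p).comap (FreeJordan.liftLinear σ)) hf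
  rintro _ ⟨m, rfl, rfl⟩
  change FreeJordan.lift σ (FreeJordan.monomial K GrVar m) ∈ 𝒜 (wordParity m)
  clear hf
  induction m using WithOne.recOneCoe with
  | one =>
    rw [FreeJordan.monomial_one, map_one]
    exact h₁
  | coe m =>
    induction m with
    | ih1 x => exact (FreeJordan.lift_of (K := K) σ x).symm ▸ hσ x
    | ih2 m m' h h' =>
      have e : ((m * m' : FreeMagma GrVar) : WithOne (FreeMagma GrVar)) = m * m' :=
        WithOne.coe_mul m m'
      rw [e, FreeJordan.monomial_mul, map_mul, wordParity_mul]
      exact hmul _ _ _ _ h h'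

end FreeGrJordan

/-! ### The graded identities of `J₂` -/

namespace SymMat2
variable {K : Type*} [Field K]

theorem a_mul_b : (a * b : SymMat2 K) = 0 := by
  apply Subtype.ext
  rw [coe_mul]
  ext i j
  fin_cases i <;> fin_cases j <;> simp [a, b]

theorem mem_grading_zero {A : SymMat2 K} :
    A ∈ nonscalarGrading K 0 ↔ ∃ α β : K, A = α • 1 + β • a := by
  rw [nonscalarGrading, if_pos rfl, Submodule.mem_span_pair]
  exact ⟨fun ⟨α, β, h⟩ => ⟨α, β, h.symm⟩, fun ⟨α, β, h⟩ => ⟨α, β, h.symm⟩⟩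

theorem mem_grading_one {A : SymMat2 K} :
    A ∈ nonscalarGrading K 1 ↔ ∃ γ : K, A = γ • b := by
  rw [nonscalarGrading, if_neg one_ne_zero, Submodule.mem_span_singleton]
  exact ⟨fun ⟨γ, h⟩ => ⟨γ, h.symm⟩, fun ⟨γ, h⟩ => ⟨γ, h.symm⟩⟩

theorem b_mul_a : (b * a : SymMat2 K) = 0 := by
  rw [SymMat2.mul_comm, a_mul_b]

variable [NeZero (2 : K)]

theorem a_mul_a : (a * a : SymMat2 K) = 1 := by
  have h2 : (2 : K) ≠ 0 := NeZero.ne 2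
  apply Subtype.ext
  rw [coe_mul, coe_one]
  ext i j
  fin_cases i <;> fin_cases j <;> simp [a] <;> field_simp <;> norm_num

theorem b_mul_b : (b * b : SymMat2 K) = 1 := by
  have h2 : (2 : K) ≠ 0 := NeZero.ne 2
  apply Subtype.ext
  rw [coe_mul, coe_one]
  ext i j
  fin_cases i <;> fin_cases j <;> simp [b] <;> field_simp <;> norm_num

theorem one_mem_grading : (1 : SymMat2 K) ∈ nonscalarGrading K 0 :=
  mem_grading_zero.2 ⟨1, 0, by simp⟩

theorem mul_mem_grading (p q : ZMod 2) (u v : SymMat2 K) (hu : u ∈ nonscalarGrading K p)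
    (hv : v ∈ nonscalarGrading K q) : u * v ∈ nonscalarGrading K (p + q) := by
  have h : ∀ p : ZMod 2, p = 0 ∨ p = 1 := by decide
  have h11 : (1 + 1 : ZMod 2) = 0 := rfl
  rcases h p with rfl | rfl <;> rcases h q with rfl | rfl <;>
    simp only [zero_add, add_zero, h11, mem_grading_zero, mem_grading_one] at hu hv ⊢
  · obtain ⟨α, β, rfl⟩ := hu
    obtain ⟨α', β', rfl⟩ := hv
    refine ⟨α * α' + β * β', α * β' + β * α', ?_⟩
    simp only [mul_add, add_mul, smul_mul_assoc, mul_smul_comm, one_mul, mul_one, a_mul_a]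
    module
  · obtain ⟨α, β, rfl⟩ := hu
    obtain ⟨γ, rfl⟩ := hv
    refine ⟨α * γ, ?_⟩
    simp only [add_mul, smul_mul_assoc, mul_smul_comm, one_mul, a_mul_b]
    module
  · obtain ⟨γ, rfl⟩ := hu
    obtain ⟨α, β, rfl⟩ := hv
    refine ⟨α * γ, ?_⟩
    simp only [mul_add, smul_mul_assoc, mul_smul_comm, mul_one, b_mul_a]
    module
  · obtain ⟨γ, rfl⟩ := hu
    obtain ⟨γ', rfl⟩ := hv
    refine ⟨γ * γ', 0, ?_⟩
    simp only [smul_mul_assoc, mul_smul_comm, b_mul_b]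
    module

variable (K) in
/-- The ideal of the graded identities of `J₂`. -/
noncomputable def identityIdeal : Submodule K (FreeGrJordan K) where
  carrier := gradedIdentities (nonscalarGrading K)
  add_mem' hf hg σ hσ := by rw [map_add, hf σ hσ, hg σ hσ, add_zero]
  zero_mem' σ _ := map_zero _
  smul_mem' c f hf σ hσ := by rw [FreeJordan.lift_smul, hf σ hσ, smul_zero]

/-- A graded substitution followed by a graded evaluation is again a graded evaluation. -/
theorem isGradedTIdeal_identityIdeal : IsGradedTIdeal (identityIdeal K) where
  mul_mem g f hf σ hσ := by rw [map_mul, hf σ hσ, mul_zero]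
  subst_mem τ hτ f hf σ hσ := by
    rw [FreeJordan.lift_lift]
    exact hf _ fun x => FreeGrJordan.lift_mem one_mem_grading mul_mem_grading hσ (hτ x)

/-- Evaluate at general elements `α + β a` and `γ b` by the multiplication table of `1`, `a`, `b`.
-/
theorem basisIdentity_mem_identityIdeal {f : FreeGrJordan K} (hf : BasisIdentity K f) :
    f ∈ identityIdeal K := by
  intro σ hσ
  have h₀ : ∀ i, ∃ α β : K, σ (0, i) = α • 1 + β • a := fun i => mem_grading_zero.1 (hσ (0, i))
  have h₁ : ∀ i, ∃ γ : K, σ (1, i) = γ • b := fun i => mem_grading_one.1 (hσ (1, i))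
  choose α β h₀ using h₀
  choose γ h₁ using h₁
  have h : ∀ p : ZMod 2, p = 0 ∨ p = 1 := by decide
  cases hf with
  | one p q =>
    rcases h p with rfl | rfl <;> rcases h q with rfl | rfl <;>
    simp only [xv, map_sub, map_mul, FreeJordan.lift_of, h₀, h₁, mul_add, add_mul,
      smul_mul_assoc, mul_smul_comm, one_mul, mul_one, a_mul_a, a_mul_b, b_mul_a, b_mul_b,
      smul_zero, mul_zero] <;> module
  | two =>
    simp only [yv, zv, xv, associator, map_sub, map_add, map_mul, map_nsmul, FreeJordan.lift_of,
      h₀, h₁, mul_add, add_mul, mul_sub,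
      smul_mul_assoc, mul_smul_comm, one_mul, mul_one, a_mul_a, a_mul_b, b_mul_a, b_mul_b,
      smul_zero, mul_zero, zero_mul]
    module
  | three =>
    simp only [yv, zv, xv, associator, map_sub, map_add, map_mul, FreeJordan.lift_of,
      h₀, h₁, mul_add, add_mul, mul_sub,
      smul_mul_assoc, mul_smul_comm, one_mul, mul_one, a_mul_a, a_mul_b, 
      smul_zero, mul_zero]
    module
  | four p q =>
    rcases h p with rfl | rfl <;> rcases h q with rfl | rfl <;>
    simp only [zv, xv, associator, map_sub, map_mul, FreeJordan.lift_of, h₀, h₁, mul_add, add_mul,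
      smul_mul_assoc, mul_smul_comm, one_mul, mul_one, a_mul_a, a_mul_b, b_mul_a, b_mul_b,
      smul_zero, mul_zero] <;> module
  | five p =>
    rcases h p with rfl | rfl <;>
    simp only [yv, zv, xv, associator, map_sub, map_mul, FreeJordan.lift_of, h₀, h₁, mul_add,
      add_mul, sub_mul,
      smul_mul_assoc, mul_smul_comm, one_mul, mul_one, a_mul_a, a_mul_b, b_mul_a, b_mul_b,
      smul_zero, mul_zero, zero_mul] <;> module

theorem gradedTIdealSpan_le_identityIdeal :
    gradedTIdealSpan {f | BasisIdentity K f} ≤ identityIdeal K :=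
  sInf_le ⟨isGradedTIdeal_identityIdeal, fun _ => basisIdentity_mem_identityIdeal⟩

end SymMat2

/-! ### The relatively free algebra -/

/-- The quotient of the free graded Jordan algebra by the graded T-ideal generated by `S`. -/
def RelFree {K : Type*} [Field K] (S : Set (FreeGrJordan K)) : Type _ :=
  FreeGrJordan K ⧸ gradedTIdealSpan S

namespace RelFree
variable {K : Type*} [Field K] (S : Set (FreeGrJordan K))

noncomputable instance : AddCommGroup (RelFree S) :=
  inferInstanceAs (AddCommGroup (FreeGrJordan K ⧸ gradedTIdealSpan S))

noncomputable instance : Module K (RelFree S) :=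
  inferInstanceAs (Module K (FreeGrJordan K ⧸ gradedTIdealSpan S))

/-- The quotient map, as a linear map. -/
noncomputable def mkLinear : FreeGrJordan K →ₗ[K] RelFree S := (gradedTIdealSpan S).mkQ

theorem mkLinear_surjective : Function.Surjective (mkLinear S) :=
  (gradedTIdealSpan S).mkQ_surjective

theorem mkLinear_eq_zero {f : FreeGrJordan K} : mkLinear S f = 0 ↔ f ∈ gradedTIdealSpan S :=
  Submodule.Quotient.mk_eq_zero _

noncomputable instance : One (RelFree S) := ⟨mkLinear S 1⟩

noncomputable instance : Mul (RelFree S) where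
  mul := Quotient.map₂ (· * ·) fun f f' h g g' h' => by
    rw [← Quotient.eq_iff_equiv] at h h' ⊢
    have hT := isGradedTIdeal_gradedTIdealSpan S
    have h := (Submodule.Quotient.eq _).1 h
    have h' := (Submodule.Quotient.eq _).1 h'
    refine (Submodule.Quotient.eq (gradedTIdealSpan S)).2 ?_
    -- Commutativity lets closure under left multiplication suffice for both terms.
    have e : f * g - f' * g' = g * (f - f') + f' * (g - g') := by
      rw [mul_sub, mul_sub, mul_comm g f, mul_comm g f']
      abel
    exact e ▸ add_mem (hT.mul_mem _ _ h) (hT.mul_mem _ _ h')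

theorem mkLinear_mul (f g : FreeGrJordan K) :
    mkLinear S (f * g) = mkLinear S f * mkLinear S g := rfl

theorem mkLinear_one : mkLinear S 1 = 1 := rfl

noncomputable instance : NonAssocCommRing (RelFree S) :=
  have comm : ∀ x y : RelFree S, x * y = y * x := fun x y => by
    obtain ⟨f, rfl⟩ := mkLinear_surjective S x
    obtain ⟨g, rfl⟩ := mkLinear_surjective S y
    rw [← mkLinear_mul, ← mkLinear_mul, mul_comm]
  have left : ∀ x y w : RelFree S, x * (y + w) = x * y + x * w := fun x y w => by
    obtain ⟨f, rfl⟩ := mkLinear_surjective S x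
    obtain ⟨g, rfl⟩ := mkLinear_surjective S y
    obtain ⟨k, rfl⟩ := mkLinear_surjective S w
    rw [← mkLinear_mul, ← mkLinear_mul, ← map_add, ← map_add, ← mkLinear_mul, mul_add]
  have zero : ∀ x : RelFree S, x * 0 = 0 := fun x => by
    obtain ⟨f, rfl⟩ := mkLinear_surjective S x
    rw [← map_zero (mkLinear S), ← mkLinear_mul, mul_zero]
  have one : ∀ x : RelFree S, x * 1 = x := fun x => by
    obtain ⟨f, rfl⟩ := mkLinear_surjective S x
    rw [← mkLinear_one, ← mkLinear_mul, mul_one]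
  { (inferInstance : AddCommGroup (RelFree S)), (inferInstance : Mul (RelFree S)),
    (inferInstance : One (RelFree S)) with
    mul_comm := comm
    left_distrib := left
    right_distrib := fun x y w => by rw [comm, left, comm w x, comm w y]
    mul_zero := zero
    zero_mul := fun x => by rw [comm, zero]
    mul_one := one
    one_mul := fun x => by rw [comm, one] }

instance : SMulCommClass K (RelFree S) (RelFree S) where
  smul_comm c x y := by
    obtain ⟨f, rfl⟩ := mkLinear_surjective S x
    obtain ⟨g, rfl⟩ := mkLinear_surjective S y
    simp only [smul_eq_mul]
    rw [← map_smul, ← mkLinear_mul, ← mkLinear_mul, ← map_smul, mul_smul_comm]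

instance : IsScalarTower K (RelFree S) (RelFree S) where
  smul_assoc c x y := by
    obtain ⟨f, rfl⟩ := mkLinear_surjective S x
    obtain ⟨g, rfl⟩ := mkLinear_surjective S y
    simp only [smul_eq_mul]
    rw [← map_smul, ← mkLinear_mul, ← mkLinear_mul, ← map_smul, smul_mul_assoc]

/-- The quotient map. -/
noncomputable def mk : FreeGrJordan K →+* RelFree S where
  toFun := mkLinear S
  map_one' := rfl
  map_mul' _ _ := rfl
  map_zero' := map_zero _
  map_add' := map_add _

theorem mk_surjective : Function.Surjective (mk S) := mkLinear_surjective S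

theorem mk_eq_zero {f : FreeGrJordan K} : mk S f = 0 ↔ f ∈ gradedTIdealSpan S :=
  mkLinear_eq_zero S

/-- The homogeneous components of the relatively free algebra. -/
noncomputable def component (p : ZMod 2) : Submodule K (RelFree S) :=
  (FreeGrJordan.component K p).map (mkLinear S)

variable {S}

theorem mem_component {p : ZMod 2} {x : RelFree S} :
    x ∈ component S p ↔ ∃ f ∈ FreeGrJordan.component K p, mk S f = x := Iff.rfl

theorem mul_mem_component {p q : ZMod 2} {x x' : RelFree S} (hx : x ∈ component S p)
    (hx' : x' ∈ component S q) : x * x' ∈ component S (p + q) := by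
  obtain ⟨f, hf, rfl⟩ := mem_component.1 hx
  obtain ⟨g, hg, rfl⟩ := mem_component.1 hx'
  exact mem_component.2 ⟨f * g, FreeGrJordan.mul_mem_component hf hg, map_mul _ _ _⟩

theorem exists_component_add (x : RelFree S) :
    ∃ u ∈ component S 0, ∃ w ∈ component S 1, x = u + w := by
  obtain ⟨f, rfl⟩ := mk_surjective S x
  have hf : f ∈ FreeGrJordan.component K 0 ⊔ FreeGrJordan.component K 1 :=
    FreeGrJordan.component_sup (K := K) ▸ Submodule.mem_top
  obtain ⟨u, hu, w, hw, rfl⟩ := Submodule.mem_sup.1 hf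
  exact ⟨_, mem_component.2 ⟨u, hu, rfl⟩, _, mem_component.2 ⟨w, hw, rfl⟩, map_add _ _ _⟩

/-- A statement that is additive in `x` need only be checked for homogeneous `x`. -/
theorem homogeneous_induction {P : RelFree S → Prop} (hadd : ∀ x x', P x → P x' → P (x + x'))
    (h : ∀ q, ∀ x ∈ component S q, P x) (x : RelFree S) : P x := by
  obtain ⟨u, hu, w, hw, rfl⟩ := exists_component_add x
  exact hadd _ _ (h 0 u hu) (h 1 w hw)

theorem mk_lift_eq_zero {f : FreeGrJordan K} (hf : f ∈ S) {σ : GrVar → FreeGrJordan K}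
    (hσ : ∀ x, σ x ∈ FreeGrJordan.component K x.1) : mk S (FreeJordan.lift σ f) = 0 :=
  (mk_eq_zero S).2
    ((isGradedTIdeal_gradedTIdealSpan S).subst_mem σ hσ f (subset_gradedTIdealSpan S hf))

end RelFree

/-! ### Transfer of the five identities to the quotient -/

theorem FreeGrJordan.update_mem_component {K : Type*} [Field K] {σ : GrVar → FreeGrJordan K}
    (hσ : ∀ x, σ x ∈ component K x.1) {x : GrVar} {f : FreeGrJordan K}
    (hf : f ∈ component K x.1) (x' : GrVar) : Function.update σ x f x' ∈ component K x'.1 := by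
  obtain rfl | h := eq_or_ne x' x
  · rwa [Function.update_self]
  · rw [Function.update_of_ne h]
    exact hσ x'

namespace RelFree
variable {K : Type*} [Field K] {S : Set (FreeGrJordan K)}

open FreeGrJordan in
-- Homogeneous representatives are substituted for the variables that occur and `0` for all others;
-- an arbitrary argument is first split into homogeneous parts. The next four lemmas follow the same
-- scheme.
theorem left_comm_of_component (hS : ∀ f, BasisIdentity K f → f ∈ S) {p : ZMod 2} {u v : RelFree S}
    (hu : u ∈ RelFree.component S p) (hv : v ∈ RelFree.component S p) (x : RelFree S) :
    u * (v * x) = v * (u * x) := by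
  induction x using homogeneous_induction with
  | hadd x x' h h' => simp only [mul_add, h, h']
  | h q x hx =>
    obtain ⟨u, hu₀, rfl⟩ := mem_component.1 hu
    obtain ⟨v, hv₀, rfl⟩ := mem_component.1 hv
    obtain ⟨x, hx₀, rfl⟩ := mem_component.1 hx
    have h := mk_lift_eq_zero (hS _ (.one p q))
      (update_mem_component (x := (p, 1)) (update_mem_component (x := (p, 2))
        (update_mem_component (x := (q, 3)) (fun _ => zero_mem _) hx₀) hv₀) hu₀)
    simpa [xv, FreeJordan.lift_of, Function.update_apply, sub_eq_zero] using h

open FreeGrJordan in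
theorem assoc_mul_odd_of_component (hS : ∀ f, BasisIdentity K f → f ∈ S) {u v w w' : RelFree S}
    (hu : u ∈ RelFree.component S 0) (hv : v ∈ RelFree.component S 0)
    (hw : w ∈ RelFree.component S 1) (hw' : w' ∈ RelFree.component S 1) :
    associator (u * v) w w' =
      u * associator v w w' + v * associator u w w' - 2 • (w * associator w' u v) := by
  obtain ⟨u, hu₀, rfl⟩ := mem_component.1 hu
  obtain ⟨v, hv₀, rfl⟩ := mem_component.1 hv
  obtain ⟨w, hw₀, rfl⟩ := mem_component.1 hw
  obtain ⟨w', hw'₀, rfl⟩ := mem_component.1 hw'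
  have h := mk_lift_eq_zero (hS _ .two)
    (update_mem_component (x := (0, 1)) (update_mem_component (x := (0, 2))
    (update_mem_component (x := (1, 1)) (update_mem_component (x := (1, 2))
      (fun _ => zero_mem _) hw'₀) hw₀) hv₀) hu₀)
  rw [← sub_eq_zero]
  simp only [yv, zv, xv, associator, map_sub, map_add, map_mul, map_nsmul,
    FreeJordan.lift_of] at h ⊢
  simpa [Function.update_apply, -nsmul_eq_mul] using h

open FreeGrJordan in
theorem assoc_mul_even_of_component (hS : ∀ f, BasisIdentity K f → f ∈ S) {u v u' w : RelFree S}
    (hu : u ∈ RelFree.component S 0) (hv : v ∈ RelFree.component S 0)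
    (hu' : u' ∈ RelFree.component S 0) (hw : w ∈ RelFree.component S 1) :
    associator (u * v) u' w = u * associator v u' w + v * associator u u' w := by
  obtain ⟨u, hu₀, rfl⟩ := mem_component.1 hu
  obtain ⟨v, hv₀, rfl⟩ := mem_component.1 hv
  obtain ⟨u', hu'₀, rfl⟩ := mem_component.1 hu'
  obtain ⟨w, hw₀, rfl⟩ := mem_component.1 hw
  have h := mk_lift_eq_zero (hS _ .three)
    (update_mem_component (x := (0, 1)) (update_mem_component (x := (0, 2))
    (update_mem_component (x := (0, 3)) (update_mem_component (x := (1, 1))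
      (fun _ => zero_mem _) hw₀) hu'₀) hv₀) hu₀)
  rw [← sub_eq_zero]
  simp only [yv, zv, xv, associator, map_sub, map_add, map_mul, FreeJordan.lift_of] at h ⊢
  simpa [Function.update_apply] using h

open FreeGrJordan in
theorem assoc_odd_mul_odd_of_component (hS : ∀ f, BasisIdentity K f → f ∈ S) {w w' : RelFree S}
    (hw : w ∈ RelFree.component S 1) (hw' : w' ∈ RelFree.component S 1) (x x' : RelFree S) :
    associator (w * w') x x' = 0 := by
  induction x using homogeneous_induction with
  | hadd x y h h' =>
    simp only [associator, sub_eq_zero] at h h' ⊢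
    simp only [mul_add, add_mul, h, h']
  | h p x hx =>
    induction x' using homogeneous_induction with
    | hadd x y h h' =>
      simp only [associator, sub_eq_zero] at h h' ⊢
      simp only [mul_add, h, h']
    | h q x' hx' =>
      obtain ⟨w, hw₀, rfl⟩ := mem_component.1 hw
      obtain ⟨w', hw'₀, rfl⟩ := mem_component.1 hw'
      obtain ⟨x, hx₀, rfl⟩ := mem_component.1 hx
      obtain ⟨x', hx'₀, rfl⟩ := mem_component.1 hx'
      have h := mk_lift_eq_zero (hS _ (.four p q))
        (update_mem_component (x := (1, 1)) (update_mem_component (x := (1, 2))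
        (update_mem_component (x := (p, 3)) (update_mem_component (x := (q, 4))
          (fun _ => zero_mem _) hx'₀) hx₀) hw'₀) hw₀)
      simp only [zv, xv, associator, map_sub, map_mul, FreeJordan.lift_of] at h ⊢
      simpa [Function.update_apply] using h

open FreeGrJordan in
theorem assoc_swap_of_component (hS : ∀ f, BasisIdentity K f → f ∈ S) {u v v' : RelFree S}
    (hu : u ∈ RelFree.component S 0) (hv : v ∈ RelFree.component S 0)
    (hv' : v' ∈ RelFree.component S 0) (w x : RelFree S) :
    associator (associator u v w) x v' = associator (associator u v' w) x v := by
  induction w using homogeneous_induction with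
  | hadd w w' h h' =>
    simp only [associator, mul_add, add_mul, sub_mul] at h h' ⊢
    linear_combination (norm := abel) h + h'
  | h p w hw =>
    have h01 : p = 0 ∨ p = 1 := by clear hw; revert p; decide
    obtain rfl | rfl := h01
    -- Identity 5 only covers odd `w`. For even `w` both inner associators vanish, the even
    -- component being associative.
    · have e : ∀ {v}, v ∈ RelFree.component S 0 → associator u v w = 0 := fun {v} hv => by
        rw [associator, sub_eq_zero, mul_comm, mul_comm u v, left_comm_of_component hS hw hv,
          mul_comm w u, left_comm_of_component hS hv hu]
      rw [e hv, e hv']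
      simp [associator]
    · induction x using homogeneous_induction with
      | hadd x x' h h' =>
        simp only [associator, mul_add, add_mul] at h h' ⊢
        linear_combination (norm := abel) h + h'
      | h q x hx =>
        obtain ⟨u, hu₀, rfl⟩ := mem_component.1 hu
        obtain ⟨v, hv₀, rfl⟩ := mem_component.1 hv
        obtain ⟨v', hv'₀, rfl⟩ := mem_component.1 hv'
        obtain ⟨w, hw₀, rfl⟩ := mem_component.1 hw
        obtain ⟨x, hx₀, rfl⟩ := mem_component.1 hx
        have h := mk_lift_eq_zero (hS _ (.five q))
          (update_mem_component (x := (0, 1)) (update_mem_component (x := (0, 2))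
          (update_mem_component (x := (1, 1)) (update_mem_component (x := (q, 4))
          (update_mem_component (x := (0, 3)) (fun _ => zero_mem _) hv'₀) hx₀) hw₀) hv₀) hu₀)
        rw [← sub_eq_zero]
        simp only [yv, zv, xv, associator, map_sub, map_mul, FreeJordan.lift_of] at h ⊢
        simpa [Function.update_apply] using h

/-- The relatively free algebra satisfies the five identities. -/
theorem basisLaws (hS : ∀ f, BasisIdentity K f → f ∈ S) :
    BasisLaws (RelFree.component S 0) (RelFree.component S 1) where
  one_mem := mem_component.2 ⟨1, FreeGrJordan.one_mem_component, map_one _⟩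
  mul_mem₀₀ hu hv := add_zero (0 : ZMod 2) ▸ mul_mem_component hu hv
  mul_mem₀₁ hu hv := zero_add (1 : ZMod 2) ▸ mul_mem_component hu hv
  mul_mem₁₁ hu hv := CharTwo.add_self_eq_zero (1 : ZMod 2) ▸ mul_mem_component hu hv
  exists_add := exists_component_add
  comm₀ := left_comm_of_component hS
  comm₁ := left_comm_of_component hS
  assoc_mul_odd := assoc_mul_odd_of_component hS
  assoc_mul_even := assoc_mul_even_of_component hS
  assoc_odd_mul_odd := assoc_odd_mul_odd_of_component hS
  assoc_swap := assoc_swap_of_component hS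

end RelFree

/-! ### Words with distinct evaluations are linearly independent -/

theorem MvPolynomial.prod_map_X {K σ : Type*} [Field K] [DecidableEq σ] (l : List σ) :
    (l.map (X : σ → MvPolynomial σ K)).prod =
      monomial (Multiset.toFinsupp (l : Multiset σ)) 1 := by
  induction l with
  | nil => simp
  | cons i l ih =>
    rw [List.map_cons, List.prod_cons, ih, X, monomial_mul, one_mul, ← Multiset.cons_coe,
      ← Multiset.singleton_add, map_add, Multiset.toFinsupp_singleton]

/-- Let the elements of a family be determined by lists of letters, up to permutation. If there
are linear forms that take on the elements of the family the values of the corresponding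
monomials, then the linear forms separate the points of the span of the family. -/
theorem eq_zero_of_forall_monomial {K σ F : Type*} [Field K] [Infinite K] [AddCommGroup F]
    [Module K F] {W : List σ → F → Prop}
    (hW : ∀ l l' e e', W l e → W l' e' → l.Perm l' → e = e') (L : (σ → K) → F →ₗ[K] K)
    (hL : ∀ l e x, W l e → L x e = (l.map x).prod) {e : F}
    (he : e ∈ Submodule.span K {e | ∃ l, W l e}) (h : ∀ x, L x e = 0) : e = 0 := by
  classical
  obtain ⟨c, rfl⟩ := (Finsupp.mem_span_iff_linearCombination K _ _).1 he
  -- The family is indexed by its elements, not by lists of letters, so that `hW` is exactly the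
  -- injectivity of the map to monomials.
  choose l hl using fun v : {e | ∃ l, W l e} => v.2
  let m : {e | ∃ l, W l e} → (σ →₀ ℕ) := fun v => Multiset.toFinsupp (l v : Multiset σ)
  have hm : Function.Injective m := fun v v' hv =>
    Subtype.ext (hW _ _ _ _ (hl v) (hl v')
      (Multiset.coe_eq_coe.1 (Multiset.toFinsupp.injective hv)))
  have hli := (MvPolynomial.basisMonomials σ K).linearIndependent.comp m hm
  suffices c = 0 by rw [this, map_zero]
  -- Here `K` must be infinite: a polynomial that vanishes at every point is zero.
  refine linearIndependent_iff.1 hli c (MvPolynomial.funext fun x => ?_)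
  rw [map_zero, ← h x, Finsupp.linearCombination_apply, Finsupp.linearCombination_apply,
    Finsupp.sum, Finsupp.sum, map_sum, map_sum]
  refine Finset.sum_congr rfl fun v _ => ?_
  have e : (MvPolynomial.basisMonomials σ K ∘ m) v = ((l v).map MvPolynomial.X).prod := by
    rw [MvPolynomial.prod_map_X, Function.comp_apply, MvPolynomial.coe_basisMonomials]
  rw [e, MvPolynomial.smul_eval, map_smul, hL _ _ x (hl v), map_list_prod, List.map_map,
    smul_eq_mul]
  simp [Function.comp_def]

/-- The letters of a word with three lists of generators. -/
def wordLetters (s t m : List ℕ) : List (ℕ ⊕ ℕ ⊕ ℕ) :=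
  s.map Sum.inl ++ (t.map Sum.inl ++ m.map Sum.inr).map Sum.inr

theorem List.perm_of_map_inl_append_map_inr {α β : Type*} {s s' : List α} {t t' : List β}
    (h : (s.map Sum.inl ++ t.map Sum.inr).Perm (s'.map Sum.inl ++ t'.map Sum.inr)) :
    s.Perm s' ∧ t.Perm t' := by
  have h₁ := h.filterMap Sum.getLeft?
  have h₂ := h.filterMap Sum.getRight?
  simp only [List.filterMap_append, List.filterMap_map, Function.comp_def, Sum.getLeft?_inl,
    Sum.getLeft?_inr, Sum.getRight?_inl, Sum.getRight?_inr, List.filterMap_none,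
    List.filterMap_some, List.append_nil, List.nil_append] at h₁ h₂
  exact ⟨h₁, h₂⟩

theorem wordLetters_perm {s t m s' t' m' : List ℕ}
    (h : (wordLetters s t m).Perm (wordLetters s' t' m')) :
    s.Perm s' ∧ t.Perm t' ∧ m.Perm m' :=
  have h := List.perm_of_map_inl_append_map_inr h
  ⟨h.1, List.perm_of_map_inl_append_map_inr h.2⟩

theorem prod_map_wordLetters {K : Type*} [Field K] (x : ℕ ⊕ ℕ ⊕ ℕ → K) (s t m : List ℕ) :
    ((wordLetters s t m).map x).prod = (s.map fun i => x (.inl i)).prod *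
      ((t.map fun i => x (.inr (.inl i))).prod * (m.map fun i => x (.inr (.inr i))).prod) := by
  simp [wordLetters, Function.comp_def]

/-! ### Evaluation of the words -/

namespace SymMat2
variable {K : Type*} [Field K]

/-- A matrix entry as a linear form. -/
def entry (K : Type*) [Field K] (i j : Fin 2) : SymMat2 K →ₗ[K] K where
  toFun A := (A : Matrix (Fin 2) (Fin 2) K) i j
  map_add' _ _ := rfl
  map_smul' _ _ := rfl

theorem entry_one : entry K 0 0 1 = 1 ∧ entry K 0 1 1 = 0 :=
  ⟨Matrix.one_apply_eq 0, Matrix.one_apply_ne zero_ne_one⟩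

theorem entry_a : entry K 0 0 a = 1 ∧ entry K 0 1 a = 0 := ⟨rfl, rfl⟩

theorem entry_b : entry K 0 0 b = 0 ∧ entry K 0 1 b = 1 := ⟨rfl, rfl⟩

/-- The substitution `y_i ↦ α_i + β_i a`, `z_i ↦ γ_i b`. -/
def substitution (x : ℕ ⊕ ℕ ⊕ ℕ → K) (v : GrVar) : SymMat2 K :=
  if v.1 = 0 then x (.inl v.2) • 1 + x (.inr (.inl v.2)) • a else x (.inr (.inr v.2)) • b

theorem substitution_mem (x : ℕ ⊕ ℕ ⊕ ℕ → K) (v : GrVar) :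
    substitution x v ∈ nonscalarGrading K v.1 := by
  have h : ∀ p : ZMod 2, p = 0 ∨ p = 1 := by decide
  obtain ⟨p, i⟩ := v
  rcases h p with rfl | rfl
  · exact mem_grading_zero.2 ⟨_, _, rfl⟩
  · exact mem_grading_one.2 ⟨_, rfl⟩

/-! ### Generators, words and evaluations in the relatively free algebra -/

/-- The relatively free algebra of the five identities. -/
abbrev Rel (K : Type*) [Field K] : Type _ := RelFree {f | BasisIdentity K f}

/-- The even generators of the relatively free algebra. -/
noncomputable def relY (K : Type*) [Field K] (i : ℕ) : Rel K := RelFree.mk _ (yv i)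

/-- The odd generators of the relatively free algebra. -/
noncomputable def relZ (K : Type*) [Field K] (i : ℕ) : Rel K := RelFree.mk _ (zv i)

theorem relY_mem (i : ℕ) : relY K i ∈ RelFree.component {f | BasisIdentity K f} 0 :=
  RelFree.mem_component.2 ⟨_, FreeGrJordan.of_mem_component (0, i), rfl⟩

theorem relZ_mem (i : ℕ) : relZ K i ∈ RelFree.component {f | BasisIdentity K f} 1 :=
  RelFree.mem_component.2 ⟨_, FreeGrJordan.of_mem_component (1, i), rfl⟩

theorem rel_basisLaws : BasisLaws (RelFree.component {f | BasisIdentity K f} 0)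
    (RelFree.component {f | BasisIdentity K f} 1) :=
  RelFree.basisLaws fun _ h => h

theorem rel_span_words : evenVarSpan K (relY K) ⊔ oddSpan K (relY K) (relZ K) ⊔
    evenSpan K (relY K) (relZ K) = ⊤ := by
  rw [eq_top_iff]
  intro u _
  obtain ⟨f, rfl⟩ := RelFree.mkLinear_surjective _ u
  set V := evenVarSpan K (relY K) ⊔ oddSpan K (relY K) (relZ K) ⊔ evenSpan K (relY K) (relZ K)
  suffices V.comap (RelFree.mkLinear _) = ⊤ from
    Submodule.mem_comap.1 (this ▸ Submodule.mem_top)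
  refine FreeJordan.eq_top_of_mul_mem ?_ ?_ fun f g hf hg =>
    mul_mem_span_words rel_basisLaws relY_mem relZ_mem hf hg
  · exact Submodule.mem_sup_left (Submodule.mem_sup_left (Submodule.subset_span ⟨_, .one⟩))
  · have h : ∀ p : ZMod 2, p = 0 ∨ p = 1 := by decide
    rintro ⟨p, i⟩
    rcases h p with rfl | rfl
    · refine Submodule.mem_sup_left (Submodule.mem_sup_left (Submodule.subset_span ⟨[i], ?_⟩))
      have := EvenVarWord.mul (y := relY K) i .one
      rwa [mul_one] at this
    · exact Submodule.mem_sup_left (Submodule.mem_sup_right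
        (Submodule.subset_span ⟨_, _, _, .of i⟩))

variable [NeZero (2 : K)]

/-- The evaluation of the relatively free algebra under a substitution. -/
noncomputable def relEval (x : ℕ ⊕ ℕ ⊕ ℕ → K) : Rel K →ₗ[K] SymMat2 K :=
  (gradedTIdealSpan {f | BasisIdentity K f}).liftQ (FreeJordan.liftLinear (substitution x))
    fun _ hf => gradedTIdealSpan_le_identityIdeal hf _ (substitution_mem x)

theorem relEval_mk (x : ℕ ⊕ ℕ ⊕ ℕ → K) (f : FreeGrJordan K) :
    relEval x (RelFree.mk _ f) = FreeJordan.lift (substitution x) f := rfl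

theorem relEval_mul (x : ℕ ⊕ ℕ ⊕ ℕ → K) (u v : Rel K) :
    relEval x (u * v) = relEval x u * relEval x v := by
  obtain ⟨f, rfl⟩ := RelFree.mk_surjective _ u
  obtain ⟨g, rfl⟩ := RelFree.mk_surjective _ v
  rw [← map_mul, relEval_mk, relEval_mk, relEval_mk, map_mul]

theorem relEval_one (x : ℕ ⊕ ℕ ⊕ ℕ → K) : relEval x 1 = 1 :=
  map_one (FreeJordan.lift (substitution x))

theorem relEval_relY (x : ℕ ⊕ ℕ ⊕ ℕ → K) (i : ℕ) :
    relEval x (relY K i) = x (.inl i) • 1 + x (.inr (.inl i)) • a :=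
  FreeJordan.lift_of _ _

theorem relEval_relZ (x : ℕ ⊕ ℕ ⊕ ℕ → K) (i : ℕ) :
    relEval x (relZ K i) = x (.inr (.inr i)) • b :=
  FreeJordan.lift_of _ _

theorem relEval_mem (x : ℕ ⊕ ℕ ⊕ ℕ → K) {p : ZMod 2} {u : Rel K}
    (hu : u ∈ RelFree.component {f | BasisIdentity K f} p) :
    relEval x u ∈ nonscalarGrading K p := by
  obtain ⟨f, hf, rfl⟩ := RelFree.mem_component.1 hu
  exact FreeGrJordan.lift_mem one_mem_grading mul_mem_grading (substitution_mem x) hf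

theorem relEval_oddWord (x : ℕ ⊕ ℕ ⊕ ℕ → K) {s t m : List ℕ} {w : Rel K}
    (hw : OddWord (relY K) (relZ K) s t m w) :
    relEval x w = ((wordLetters s t m).map x).prod • b := by
  rw [prod_map_wordLetters]
  induction hw with
  | of k => simp [relEval_relZ]
  | mul i _ ih =>
    rw [relEval_mul, ih, relEval_relY]
    simp only [add_mul, smul_mul_assoc, mul_smul_comm, one_mul, a_mul_b, List.map_cons,
      List.prod_cons]
    module
  | assoc i j _ ih =>
    simp only [associator, map_sub, relEval_mul, ih, relEval_relY]
    simp only [add_mul, mul_add, smul_mul_assoc, mul_smul_comm, one_mul, mul_one, a_mul_a,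
      a_mul_b, smul_zero, mul_zero, List.map_cons, List.prod_cons]
    module
  | mul_odd i j _ ih =>
    simp only [relEval_mul, ih, relEval_relZ]
    simp only [smul_mul_assoc, mul_smul_comm, one_mul, b_mul_b, List.map_cons, List.prod_cons]
    module

/-- The value is a multiple of `1` or of `a`, according to the parity of `t`. Both have `(0, 0)`
entry `1`, so a single linear form serves, and the monomial still records `t`. -/
theorem entry_relEval_evenWord (x : ℕ ⊕ ℕ ⊕ ℕ → K) {s t m : List ℕ} {e : Rel K}
    (he : EvenWord (relY K) (relZ K) s t m e) :
    entry K 0 0 (relEval x e) = ((wordLetters s t m).map x).prod := by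
  rw [prod_map_wordLetters]
  cases he with
  | mul k hw =>
    rw [relEval_mul, relEval_oddWord x hw, relEval_relZ, prod_map_wordLetters]
    simp only [smul_mul_assoc, mul_smul_comm, b_mul_b, map_smul, entry_one, smul_eq_mul,
      List.map_cons, List.prod_cons]
    ring
  | assoc j k hw =>
    simp only [associator, map_neg, map_sub, relEval_mul, relEval_oddWord x hw, relEval_relZ,
      relEval_relY, prod_map_wordLetters]
    simp only [add_mul, mul_add, smul_mul_assoc, mul_smul_comm, one_mul, mul_one, a_mul_b,
      b_mul_b, zero_mul, smul_zero, map_smul, map_add, map_zero, entry_one, entry_a, smul_eq_mul,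
      List.map_cons, List.prod_cons]
    ring

/-- The general value is a product of factors `α_i + β_i a`, not a monomial multiple of `1`; setting
`β = γ = 0` makes it one. -/
theorem entry_relEval_evenVarWord (x : ℕ → K) {s : List ℕ} {u : Rel K}
    (hu : EvenVarWord (relY K) s u) :
    entry K 0 0 (relEval (Sum.elim x 0) u) = (s.map x).prod := by
  suffices relEval (Sum.elim x 0) u = (s.map x).prod • 1 by
    rw [this, map_smul, entry_one.1, smul_eq_mul, mul_one]
  induction hu with
  | one => simp [relEval_one]
  | mul i _ ih =>
    rw [relEval_mul, ih, relEval_relY]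
    simp only [Sum.elim_inl, Sum.elim_inr, Pi.zero_apply, zero_smul, add_zero, smul_mul_assoc,
      one_mul, smul_smul, List.map_cons, List.prod_cons]

/-- The `(0, 1)` entry isolates the odd part `w`. For the even part, `β = γ = 0` isolates `u`; once
`u = 0`, the `(0, 0)` entry determines `e`. -/
theorem rel_eq_zero [Infinite K] {f : Rel K} (h : ∀ x, relEval x f = 0) : f = 0 := by
  have hB := rel_basisLaws (K := K)
  have hf : f ∈ evenVarSpan K (relY K) ⊔ oddSpan K (relY K) (relZ K) ⊔
    evenSpan K (relY K) (relZ K) := rel_span_words (K := K) ▸ Submodule.mem_top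
  obtain ⟨_, hf₁, e, he, rfl⟩ := Submodule.mem_sup.1 hf
  obtain ⟨u, hu, w, hw, rfl⟩ := Submodule.mem_sup.1 hf₁
  have hu₀ : u ∈ RelFree.component {f | BasisIdentity K f} 0 :=
    (Submodule.span_le.2 fun _ ⟨_, hv⟩ => hv.mem hB relY_mem : evenVarSpan K (relY K) ≤ _) hu
  have he₀ := evenSpan_le hB relY_mem relZ_mem he
  have hw₁ := oddSpan_le hB relY_mem relZ_mem hw
  have h01 : ∀ x {v : Rel K}, v ∈ RelFree.component {f | BasisIdentity K f} 0 →
      entry K 0 1 (relEval x v) = 0 := fun x v hv => by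
    obtain ⟨α, β, hv⟩ := mem_grading_zero.1 (relEval_mem x hv)
    simp [hv, entry_one, entry_a]
  have h00 : ∀ x, entry K 0 0 (relEval x w) = 0 := fun x => by
    obtain ⟨γ, hv⟩ := mem_grading_one.1 (relEval_mem x hw₁)
    simp [hv, entry_b]
  have hw0 : w = 0 := by
    refine eq_zero_of_forall_monomial
      (W := fun l w => ∃ s t m, l = wordLetters s t m ∧ OddWord (relY K) (relZ K) s t m w) ?_
      (fun x => entry K 0 1 ∘ₗ relEval x) ?_ (Submodule.span_mono ?_ hw) fun x => ?_
    · rintro _ _ w w' ⟨s, t, m, rfl, hw⟩ ⟨s', t', m', rfl, hw'⟩ hl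
      obtain ⟨hs, ht, hm⟩ := wordLetters_perm hl
      exact hw.unique hB relY_mem relZ_mem hw' hs ht hm
    · rintro _ w x ⟨s, t, m, rfl, hw⟩
      rw [LinearMap.comp_apply, relEval_oddWord x hw, map_smul, entry_b.2, smul_eq_mul, mul_one]
    · exact fun _ ⟨s, t, m, hw⟩ => ⟨_, s, t, m, rfl, hw⟩
    · have := congrArg (entry K 0 1) (h x)
      rwa [map_add, map_add, map_add, map_add, h01 x hu₀, h01 x he₀, add_zero, zero_add,
        map_zero] at this
  have hue : ∀ x, entry K 0 0 (relEval x u) + entry K 0 0 (relEval x e) = 0 := fun x => by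
    have := congrArg (entry K 0 0) (h x)
    rwa [map_add, map_add, map_add, map_add, h00, add_zero, map_zero] at this
  have hu0 : u = 0 := by
    refine eq_zero_of_forall_monomial (W := EvenVarWord (relY K)) ?_
      (fun x => entry K 0 0 ∘ₗ relEval (Sum.elim x 0)) ?_ hu fun x => ?_
    · exact fun _ _ _ _ hv hv' hs => hv.unique hB relY_mem hv' hs
    · exact fun _ _ x hv => entry_relEval_evenVarWord x hv
    · have : entry K 0 0 (relEval (Sum.elim x 0) e) = 0 := by
        refine (Submodule.span_le.2 ?_ : evenSpan K (relY K) (relZ K) ≤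
          LinearMap.ker (entry K 0 0 ∘ₗ relEval (Sum.elim x 0))) he
        rintro v ⟨s, t, m, hv⟩
        -- Only the presence of some odd generator `z_k` matters: its factor `γ_k = 0` annihilates
        -- the value.
        obtain ⟨k, m, rfl, -⟩ := hv.eq hB relY_mem relZ_mem
        rw [SetLike.mem_coe, LinearMap.mem_ker, LinearMap.comp_apply,
          entry_relEval_evenWord _ hv, prod_map_wordLetters]
        simp
      have h' := hue (Sum.elim x 0)
      rwa [this, add_zero] at h'
  have he0 : e = 0 := by
    refine eq_zero_of_forall_monomial
      (W := fun l w => ∃ s t m, l = wordLetters s t m ∧ EvenWord (relY K) (relZ K) s t m w) ?_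
      (fun x => entry K 0 0 ∘ₗ relEval x) ?_ (Submodule.span_mono ?_ he) fun x => ?_
    · rintro _ _ w w' ⟨s, t, m, rfl, hw⟩ ⟨s', t', m', rfl, hw'⟩ hl
      obtain ⟨hs, ht, hm⟩ := wordLetters_perm hl
      exact hw.unique hB relY_mem relZ_mem hw' hs ht hm
    · rintro _ w x ⟨s, t, m, rfl, hw⟩
      exact entry_relEval_evenWord x hw
    · exact fun _ ⟨s, t, m, hw⟩ => ⟨_, s, t, m, rfl, hw⟩
    · have := hue x
      rwa [hu0, map_zero, map_zero, zero_add] at this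
  rw [hu0, hw0, he0, add_zero, add_zero]

end SymMat2

theorem theorem2 {K : Type*} [Field K] [Infinite K] [NeZero (2 : K)] :
    gradedIdentities (SymMat2.nonscalarGrading K) =
      (gradedTIdealSpan {f | BasisIdentity K f} : Set (FreeGrJordan K)) := by
  refine Set.Subset.antisymm (fun f hf => ?_) SymMat2.gradedTIdealSpan_le_identityIdeal
  exact (RelFree.mk_eq_zero _).1 (SymMat2.rel_eq_zero fun x => hf _ (SymMat2.substitution_mem x))
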